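/- Let $\mathbb{T}^d=\mathbb{R}^d/\mathbb{Z}^d$ be the $d$-dimensional torus, identified with $[-1/2,1/2]^d$, and let all integrals and function spaces be over $\mathbb{T}^d$. A vector field $b\in L^p(\mathbb{T}^d;\mathbb{R}^d)$ is called divergence-free if $\int b\cdot\nabla\phi=0$ for all $\phi\in C^\infty(\mathbb{T}^d)$. Given such $b$ and the conjugate exponent $p'=p/(p-1)$, a function $u\in H^1(\mathbb{T}^d)\cap L^{p'}(\mathbb{T}^d)$ with $\int u=0$ is called a zero-mean weak solution of $-\mathrm{div}(\nabla u+bu)=0$ if $$\int \left(-u\,\Delta\phi+bu\cdot\nabla\phi\right)=0\qquad\text{for all }\phi\in C^\infty(\mathbb{T}^d)\text{ with }\int\phi=0 .$$ **Theorem (Asymptotically sharp nonuniqueness).** Let $d\ge 4$ and $p\in\left(1,\frac{2(d-1)}{d+1}\right)$. Given $\epsilon>0$ and a divergence-free $b_0\in L^p(\mathbb{T}^d;\mathbb{R}^d)$, there exists a divergence-free $b\in L^p(\mathbb{T}^d;\mathbb{R}^d)$ such that $\|b-b_0\|_{L^p}\le\epsilon$ and $-\mathrm{div}(\nabla u+bu)=0$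 has a nontrivial zero-mean weak solution $u\in H^1\cap L^{p'}$, that is, one which is not almost everywhere equal to $0$. Consequently, the set of divergence-free drifts $b\in L^p$ for which $-\mathrm{div}(\nabla u+bu)=0$ has at least two distinct zero-mean weak solutions in $H^1\cap L^{p'}$ is dense in the divergence-free subspace of $L^p(\mathbb{T}^d;\mathbb{R}^d)$. -/

import Mathlib

open MeasureTheory

noncomputable section

namespace TorusDrift

/-- Euclidean space `ℝ^d`. -/
abbrev Space (d : ℕ) : Type := EuclideanSpace ℝ (Fin d)

/-- The fundamental domain `[-1/2, 1/2]^d` of the torus `𝕋^d = ℝ^d / ℤ^d`. -/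
def cube (d : ℕ) : Set (Space d) := {x | ∀ i, x i ∈ Set.Icc (-(1 / 2) : ℝ) (1 / 2)}

/-- Lebesgue measure on the torus, realised on the fundamental domain. The faces of the cube are
null sets, so `Lp` of this measure is `L^p(𝕋^d)`; the identification of opposite faces enters
through the test functions, which are periodic. -/
def torusMeasure (d : ℕ) : Measure (Space d) := volume.restrict (cube d)

/-- Test functions, `C^∞(𝕋^d)`: smooth functions on `ℝ^d` of period one in each coordinate. -/
structure IsTest {d : ℕ} (φ : Space d → ℝ) : Prop where
  smooth : ContDiff ℝ (⊤ : ℕ∞) φ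
  periodic : ∀ (x : Space d) (i : Fin d), φ (x + EuclideanSpace.single i (1 : ℝ)) = φ x

/-- `∫_{𝕋^d} u = 0`. -/
def HasZeroMean {d : ℕ} (u : Space d → ℝ) : Prop := ∫ x, u x ∂(torusMeasure d) = 0

/-- Weakly divergence-free vector fields: `∫ b · ∇φ = 0` for all `φ ∈ C^∞(𝕋^d)`. -/
def IsDivFree {d : ℕ} (b : Space d → Space d) : Prop :=
  ∀ φ : Space d → ℝ, IsTest φ → ∫ x, inner ℝ (b x) (gradient φ x) ∂(torusMeasure d) = 0

/-- `g` is the weak gradient of `u` on the torus: `∫ u ∂ᵢφ = - ∫ gᵢ φ` for all `i` and all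
`φ ∈ C^∞(𝕋^d)`. -/
def IsWeakGradient {d : ℕ} (u : Space d → ℝ) (g : Space d → Space d) : Prop :=
  ∀ φ : Space d → ℝ, IsTest φ → ∀ i : Fin d,
    ∫ x, u x * fderiv ℝ φ x (EuclideanSpace.single i (1 : ℝ)) ∂(torusMeasure d) =
      -∫ x, g x i * φ x ∂(torusMeasure d)

/-- `u ∈ H^1(𝕋^d)`: `u` is square integrable and has a square integrable weak gradient. -/
def MemH1 {d : ℕ} (u : Space d → ℝ) : Prop :=
  MemLp u 2 (torusMeasure d) ∧
    ∃ g : Space d → Space d, MemLp g 2 (torusMeasure d) ∧ IsWeakGradient u g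

/-- The weak form of `-div(∇u + b u) = 0` on the torus:
`∫ (-u Δφ + u b · ∇φ) = 0` for all zero-mean `φ ∈ C^∞(𝕋^d)`. -/
def SolvesWeakly {d : ℕ} (b : Space d → Space d) (u : Space d → ℝ) : Prop :=
  ∀ φ : Space d → ℝ, IsTest φ → HasZeroMean φ →
    ∫ x, (-(u x * Laplacian.laplacian φ x) + u x * inner ℝ (b x) (gradient φ x))
      ∂(torusMeasure d) = 0

/-- `u` is a zero-mean weak solution of `-div(∇u + b u) = 0` in the class `H^1 ∩ L^{p'}`, where
`p'` is the exponent conjugate to `p`. -/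
structure IsSolution {d : ℕ} (p : ℝ) (b : Space d → Space d) (u : Space d → ℝ) : Prop where
  memH1 : MemH1 u
  memLp : MemLp u (ENNReal.ofReal p.conjExponent) (torusMeasure d)
  zeroMean : HasZeroMean u
  weak : SolvesWeakly b u

/-- The space `L^p(𝕋^d; ℝ^d)`. -/
abbrev Drift (d : ℕ) (p : ℝ) : Type := Lp (Space d) (ENNReal.ofReal p) (torusMeasure d)

/-- The divergence-free subspace of `L^p(𝕋^d; ℝ^d)`. -/
def divFreeDrifts (d : ℕ) (p : ℝ) : Set (Drift d p) := {b | IsDivFree (b : Space d → Space d)}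

/-- Nonuniqueness for the drift `b`: the homogeneous equation has two zero-mean weak solutions
in `H^1 ∩ L^{p'}` that are different as elements of that space (that is, not a.e. equal). -/
def HasNonuniqueness {d : ℕ} (p : ℝ) (b : Space d → Space d) : Prop :=
  ∃ u v : Space d → ℝ, IsSolution p b u ∧ IsSolution p b v ∧ ¬ u =ᵐ[torusMeasure d] v

end TorusDrift

end

/-! The proof is convex integration with concentrated, oscillating tubes. Write q = p'. Consider
triples (b, u, R) with div b = 0 and div(∇u + bu) = div R. Such a triple is corrected to (b + w, u -
ϑ, R'), where w and ϑ sit on the same thin periodic tubes in direction e_i and ϑw has local average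
close to R_i e_i. The quadratic term -ϑw then cancels R_i e_i, up to a divergence-free field and an
error small in L^1. The other new terms uw, ∇ϑ and ϑb must be small in L^1 by themselves.

The tubes come from a positive periodic product Φ of mean one, depending on the d - 1 variables
other than x_i, and factored as Φ = Φ^(1/p) Φ^(1/q). With smooth g ≈ R_i and a ≥ |g|, a > 0, the
main part of w is κ a^(1/p) Φ^(1/p) e_i, and ϑ is κ⁻¹ g a^(-1/p) Φ^(1/q). As Φ concentrates, a power
of Φ with exponent in (0, 1) has integral tending to zero, so w → 0 in L^1 and ϑ → 0 in L^2, while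
their product keeps its average. If each factor has width 1/μ, the squared L^2 norm of ∇Φ^(1/q) is
of order at most μ^(2 - (d-1)(1 - 2/q)). It vanishes in the limit when (d-1)(1/2 - 1/q) > 1, which
is the hypothesis p < 2(d-1)/(d+1).

The weight κ decides how the defect is shared. If ρ exceeds the L^1 norm of R_i, then w has L^p norm
at most η and ϑ has L^q norm at most 2ρ/η, with η free. Hence even a large defect is removed at an
arbitrarily small cost in the drift and in the H^1 norm of u; only the L^q norm of u pays. Starting
from (b₀, u₀, ∇u₀ + u₀b₀) with u₀ a cosine, the iteration with ρ of order 4^(-n) and η of order ε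
2^(-n) converges: b in L^p, u in L^q and in H^1, R to zero in L^1. The limit of u is L^2-close to
u₀, hence not constant; constants solve the equation because div b = 0, so the mean can be
subtracted.

The components of R are removed one after the other, each perturbation becoming background for the
next, so tubes in different directions need not be disjoint.

The weight is carried by `exists_divFree_corrector` (averaging of an oscillating field modulo
divergence-free fields), `tendsto_energy_profile` (the exponent condition), `exists_mikado` (the
tubes), `Subsolution.exists_step` (the removal of one component) and `exists_drift_near` (the
limit). -/

noncomputable section

namespace TorusDrift

/-! ### Integration over the torus -/

variable {d : ℕ}

/-- The `k`-th partial derivative. -/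
def pd (k : Fin d) (f : Space d → ℝ) (x : Space d) : ℝ :=
  fderiv ℝ f x (EuclideanSpace.single k (1 : ℝ))

theorem cube_eq_preimage : cube d = (WithLp.ofLp : Space d → Fin d → ℝ) ⁻¹'
    (Set.univ.pi fun _ => Set.Icc (-(1 / 2) : ℝ) (1 / 2)) := by
  ext x; simp only [cube, Set.mem_ofPred_eq, Set.mem_preimage, Set.mem_pi, Set.mem_univ, true_imp_iff]

theorem isCompact_cube : IsCompact (cube d) := by
  rw [cube_eq_preimage]
  exact (PiLp.homeomorph 2 (fun _ : Fin d => ℝ)).isCompact_preimage.2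
    (isCompact_univ_pi fun _ => isCompact_Icc)

theorem measurableSet_cube : MeasurableSet (cube d) := isCompact_cube.isClosed.measurableSet

/-- The interval measure whose `d`-fold product is the torus measure. -/
abbrev intervalMeasure : Measure ℝ := volume.restrict (Set.Icc (-(1 / 2) : ℝ) (1 / 2))

/-- This makes Fubini available for products of functions of one coordinate, the only integrals that
are ever computed exactly. -/
theorem torusMeasure_eq_map : torusMeasure d =
    (Measure.pi fun _ : Fin d => intervalMeasure).map
      (MeasurableEquiv.toLp 2 (Fin d → ℝ)) := by
  rw [← Measure.restrict_pi_pi, ← volume_pi]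
  have h : MeasurePreserving (MeasurableEquiv.toLp 2 (Fin d → ℝ)) volume volume :=
    PiLp.volume_preserving_toLp (Fin d)
  have h2 := h.restrict_preimage (s := cube d) measurableSet_cube
  rw [torusMeasure, ← h2.map_eq, cube_eq_preimage]
  rfl

theorem integral_torus (f : Space d → ℝ) : ∫ x, f x ∂(torusMeasure d) =
    ∫ y, f (WithLp.toLp 2 y) ∂(Measure.pi fun _ : Fin d => intervalMeasure) := by
  rw [torusMeasure_eq_map, MeasureTheory.integral_map_equiv]
  rfl

instance : IsProbabilityMeasure intervalMeasure := by
  constructor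
  norm_num [intervalMeasure]

instance : IsProbabilityMeasure (torusMeasure d) := by
  rw [torusMeasure_eq_map]
  exact Measure.isProbabilityMeasure_map (MeasurableEquiv.measurable _).aemeasurable

theorem ae_mem_cube : ∀ᵐ x ∂(torusMeasure d), x ∈ cube d :=
  ae_restrict_mem measurableSet_cube

theorem integral_prod_coord (f : Fin d → ℝ → ℝ) :
    ∫ x, ∏ k, f k (x k) ∂(torusMeasure d) = ∏ k, ∫ t, f k t ∂intervalMeasure := by
  rw [integral_torus]
  exact integral_fintype_prod_eq_prod f

theorem exists_bound_cube {F : Type*} [NormedAddCommGroup F] {f : Space d → F}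
    (hf : Continuous f) : ∃ C : ℝ, 0 < C ∧ ∀ x ∈ cube d, ‖f x‖ ≤ C := by
  obtain ⟨C, hC⟩ := isCompact_cube.exists_bound_of_continuousOn (s := cube d) hf.continuousOn
  exact ⟨max C 1, by positivity, fun x hx => (hC x hx).trans (le_max_left _ _)⟩

theorem memLp_of_continuous {F : Type*} [NormedAddCommGroup F] {f : Space d → F}
    [SecondCountableTopologyEither (Space d) F] (hf : Continuous f)
    (q : ENNReal) : MemLp f q (torusMeasure d) := by
  obtain ⟨C, _, hC⟩ := exists_bound_cube hf
  exact MemLp.of_bound hf.aestronglyMeasurable C (ae_mem_cube.mono hC)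

theorem integrable_of_continuous {F : Type*} [NormedAddCommGroup F] {f : Space d → F}
    [SecondCountableTopologyEither (Space d) F] (hf : Continuous f) :
    Integrable f (torusMeasure d) :=
  memLp_one_iff_integrable.1 (memLp_of_continuous hf 1)

theorem integrable_inner_of_continuous {b g : Space d → Space d}
    (hb : Integrable b (torusMeasure d)) (hg : Continuous g) :
    Integrable (fun x => inner ℝ (b x) (g x)) (torusMeasure d) := by
  obtain ⟨C, _, hC⟩ := exists_bound_cube hg
  refine Integrable.mono' (hb.norm.mul_const C)
    (hb.aestronglyMeasurable.inner hg.aestronglyMeasurable) ?_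
  filter_upwards [ae_mem_cube] with x hx
  exact (norm_inner_le_norm _ _).trans (by gcongr; exact hC x hx)

/-! ### Periodic test functions, partial derivatives, integration by parts -/

namespace IsTest

variable {φ χ : Space d → ℝ}

theorem continuous (h : IsTest φ) : Continuous φ := h.smooth.continuous

theorem differentiable (h : IsTest φ) : Differentiable ℝ φ := h.smooth.differentiable (by simp)

theorem integrable (h : IsTest φ) : Integrable φ (torusMeasure d) :=
  integrable_of_continuous h.continuous

theorem const (c : ℝ) : IsTest (fun _ : Space d => c) := ⟨contDiff_const, fun _ _ => rfl⟩

theorem add (h : IsTest φ) (h' : IsTest χ) : IsTest (fun x => φ x + χ x) :=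
  ⟨h.smooth.add h'.smooth, fun x i => by simp only [h.periodic x i, h'.periodic x i]⟩

theorem sub (h : IsTest φ) (h' : IsTest χ) : IsTest (fun x => φ x - χ x) :=
  ⟨h.smooth.sub h'.smooth, fun x i => by simp only [h.periodic x i, h'.periodic x i]⟩

theorem mul (h : IsTest φ) (h' : IsTest χ) : IsTest (fun x => φ x * χ x) :=
  ⟨h.smooth.mul h'.smooth, fun x i => by simp only [h.periodic x i, h'.periodic x i]⟩

theorem const_mul (c : ℝ) (h : IsTest φ) : IsTest (fun x => c * φ x) := (const c).mul h

theorem prod {ι : Type*} (s : Finset ι) {f : ι → Space d → ℝ} (h : ∀ j ∈ s, IsTest (f j)) :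
    IsTest (fun x => ∏ j ∈ s, f j x) :=
  ⟨contDiff_prod fun j hj => (h j hj).smooth,
    fun x i => Finset.prod_congr rfl fun j hj => (h j hj).periodic x i⟩

theorem comp {F : ℝ → ℝ} {s : Set ℝ} (hF : ContDiffOn ℝ (⊤ : ℕ∞) F s) (hs : IsOpen s)
    (h : IsTest φ) (hm : ∀ x, φ x ∈ s) : IsTest (fun x => F (φ x)) := by
  refine ⟨?_, fun x i => by simp only [h.periodic x i]⟩
  rw [contDiff_iff_contDiffAt]
  intro x
  exact ((hF.contDiffAt (hs.mem_nhds (hm x))).comp x h.smooth.contDiffAt)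

theorem coord {f : ℝ → ℝ} (hf : ContDiff ℝ (⊤ : ℕ∞) f) (hp : Function.Periodic f 1) (k : Fin d) :
    IsTest (fun x : Space d => f (x k)) := by
  refine ⟨hf.comp (by fun_prop), fun x i => ?_⟩
  by_cases hik : k = i
  · subst hik; simp [hp (x k)]
  · simp [hik]

theorem contDiff_pd (h : IsTest φ) (k : Fin d) : ContDiff ℝ (⊤ : ℕ∞) (pd k φ) :=
  (h.smooth.fderiv_right (m := (⊤ : ℕ∞)) (by simp)).clm_apply contDiff_const

theorem pd (h : IsTest φ) (k : Fin d) : IsTest (pd k φ) := by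
  refine ⟨h.contDiff_pd k, fun x i => ?_⟩
  have : (fun y => φ (y + EuclideanSpace.single i (1 : ℝ))) = φ := funext fun y => h.periodic y i
  unfold TorusDrift.pd
  rw [← fderiv_comp_add_right, this]

end IsTest

theorem gradient_apply (φ : Space d → ℝ) (x : Space d) (k : Fin d) :
    gradient φ x k = pd k φ x := by
  have : inner ℝ (gradient φ x) (EuclideanSpace.single k (1 : ℝ)) = gradient φ x k := by
    rw [EuclideanSpace.inner_single_right]; simp
  rw [← this, pd, inner_gradient_left]

theorem inner_gradient_eq_sum (v : Space d) (φ : Space d → ℝ) (x : Space d) :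
    inner ℝ v (gradient φ x) = ∑ k, v k * pd k φ x := by
  rw [PiLp.inner_apply]
  simp [gradient_apply, mul_comm]

theorem IsTest.continuous_gradient {φ : Space d → ℝ} (h : IsTest φ) :
    Continuous (gradient φ) := by
  have : gradient φ = fun x => WithLp.toLp 2 fun k => TorusDrift.pd k φ x := by
    ext x k; simp [gradient_apply]
  rw [this]
  exact (PiLp.continuous_toLp 2 _).comp (continuous_pi fun k => (h.pd k).continuous)

theorem pd_mul {f g : Space d → ℝ} (hf : IsTest f) (hg : IsTest g) (k : Fin d) (x : Space d) :
    pd k (fun y => f y * g y) x = pd k f x * g x + f x * pd k g x := by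
  unfold pd
  rw [fderiv_fun_mul (hf.differentiable x) (hg.differentiable x)]
  simp; ring

theorem pd_sub {f g : Space d → ℝ} (hf : IsTest f) (hg : IsTest g) (k : Fin d) (x : Space d) :
    pd k (fun y => f y - g y) x = pd k f x - pd k g x := by
  unfold pd
  rw [fderiv_fun_sub (hf.differentiable x) (hg.differentiable x)]
  simp

theorem pd_coord {f : ℝ → ℝ} (hf : Differentiable ℝ f) (j k : Fin d) (x : Space d) :
    pd k (fun y : Space d => f (y j)) x = if j = k then deriv f (x j) else 0 := by
  have h1 : HasFDerivAt (fun y : Space d => y j) (EuclideanSpace.proj j : Space d →L[ℝ] ℝ) x :=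
    (EuclideanSpace.proj j : Space d →L[ℝ] ℝ).hasFDerivAt
  have h2 := ((hf (x j)).hasDerivAt.comp_hasFDerivAt x h1).fderiv
  unfold pd
  change fderiv ℝ (f ∘ fun y : Space d => y j) x _ = _
  rw [h2]
  by_cases h : j = k
  · simp [h]
  · simp [h]

theorem pd_comm {f : Space d → ℝ} (hf : IsTest f) (j k : Fin d) (x : Space d) :
    pd j (pd k f) x = pd k (pd j f) x := by
  have hsym : IsSymmSndFDerivAt ℝ f x :=
    (hf.smooth.contDiffAt).isSymmSndFDerivAt (by
      rw [minSmoothness_of_isRCLikeNormedField]; exact WithTop.coe_le_coe.2 le_top)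
  have h (a b : Fin d) : pd a (pd b f) x = fderiv ℝ (fderiv ℝ f) x
      (EuclideanSpace.single a 1) (EuclideanSpace.single b 1) := by
    unfold pd
    rw [fderiv_clm_apply ((hf.smooth.fderiv_right (m := (⊤ : ℕ∞)) (by simp)).differentiable
      (by simp) x) (differentiableAt_const _)]
    simp
  rw [h, h, hsym]

theorem laplacian_eq_sum_pd {f : Space d → ℝ} (hf : IsTest f) (x : Space d) :
    Laplacian.laplacian f x = ∑ k, pd k (pd k f) x := by
  rw [InnerProductSpace.laplacian_eq_iteratedFDeriv_orthonormalBasis f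
    (EuclideanSpace.basisFun (Fin d) ℝ)]
  refine Finset.sum_congr rfl fun k _ => ?_
  unfold pd
  rw [iteratedFDeriv_two_apply, fderiv_clm_apply ((hf.smooth.fderiv_right (m := (⊤ : ℕ∞))
    (by simp)).differentiable (by simp) x) (differentiableAt_const _)]
  simp

/-- The integral of a derivative of a periodic function vanishes. -/
theorem integral_pd_eq_zero {f : Space d → ℝ} (hf : IsTest f) (k : Fin d) :
    ∫ x, pd k f x ∂(torusMeasure d) = 0 := by
  obtain ⟨n, rfl⟩ : ∃ n, d = n + 1 := ⟨d - 1, by have := k.pos; omega⟩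
  rw [integral_torus, ← Measure.restrict_pi_pi, ← volume_pi, Set.pi_univ_Icc]
  set L : (Fin (n + 1) → ℝ) →L[ℝ] Space (n + 1) :=
    (PiLp.continuousLinearEquiv 2 ℝ (fun _ : Fin (n + 1) => ℝ)).symm.toContinuousLinearMap with hL
  have hLa (y) : WithLp.toLp 2 y = L y := rfl
  have hc : Continuous fun y => f (L y) := hf.continuous.comp L.continuous
  -- Divergence theorem on the cube for the field f e_k. Only the two faces normal to e_k
  -- contribute, and periodicity makes them cancel.
  have key := integral_divergence_of_hasFDerivAt_off_countable'
    (fun _ : Fin (n + 1) => (-(1 / 2) : ℝ)) (fun _ => (1 / 2 : ℝ)) (fun _ => by norm_num)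
    (fun i y => if i = k then f (L y) else 0)
    (fun i y => if i = k then (fderiv ℝ f (L y)).comp L else 0) ∅ Set.countable_empty
    (fun i => by by_cases h : i = k <;> simp [h, hc.continuousOn, continuousOn_const])
    (fun y _ i => by
      by_cases h : i = k
      · simp only [h, if_true]
        exact (hf.differentiable (L y)).hasFDerivAt.comp y L.hasFDerivAt
      · simp [h, hasFDerivAt_const])
    (by
      refine ContinuousOn.integrableOn_compact isCompact_Icc (Continuous.continuousOn ?_)
      refine continuous_finsetSum _ fun i _ => ?_
      by_cases h : i = k
      · simp only [h, if_true]
        exact (((hf.smooth.continuous_fderiv (by simp)).comp L.continuous).clm_comp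
          continuous_const).clm_apply continuous_const
      · simp only [h, if_false]; exact continuous_const)
  have hsum (y) : (∑ i, (if i = k then (fderiv ℝ f (L y)).comp L else 0) (Pi.single i 1)) =
      pd k f (L y) := by
    rw [Finset.sum_eq_single k (by intro j _ hj; simp [hj]) (by simp)]
    simp only [if_true]; rfl
  simp only [hsum] at key
  simp only [hLa]
  rw [key]
  refine Finset.sum_eq_zero fun i _ => ?_
  by_cases h : i = k
  · subst h
    simp only [if_true]
    rw [sub_eq_zero]
    congr 1
    funext z
    rw [← hf.periodic (L (i.insertNth (-(1 / 2)) z)) i]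
    congr 1
    ext j
    simp only [hL]
    refine Fin.succAboveCases i ?_ (fun j => ?_) j
    · simp; norm_num
    · simp
  · simp [h]

theorem integral_mul_pd {f g : Space d → ℝ} (hf : IsTest f) (hg : IsTest g) (k : Fin d) :
    ∫ x, f x * pd k g x ∂(torusMeasure d) = -∫ x, pd k f x * g x ∂(torusMeasure d) := by
  have h := integral_pd_eq_zero (hf.mul hg) k
  simp only [pd_mul hf hg] at h
  rw [integral_add ((hf.pd k).mul hg).integrable (hf.mul (hg.pd k)).integrable] at h
  linarith

/-! ### Divergence-free fields -/

theorem IsDivFree.add {b c : Space d → Space d} (hb : IsDivFree b) (hc : IsDivFree c)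
    (hbi : Integrable b (torusMeasure d)) (hci : Integrable c (torusMeasure d)) :
    IsDivFree (fun x => b x + c x) := by
  intro φ hφ
  simp only [inner_add_left]
  rw [integral_add (integrable_inner_of_continuous hbi hφ.continuous_gradient)
    (integrable_inner_of_continuous hci hφ.continuous_gradient), hb φ hφ, hc φ hφ, add_zero]

theorem IsDivFree.const_smul {b : Space d → Space d} (hb : IsDivFree b) (c : ℝ) :
    IsDivFree (fun x => c • b x) := by
  intro φ hφ
  simp only [inner_smul_left]
  rw [integral_const_mul, hb φ hφ, mul_zero]

theorem IsDivFree.congr_ae {b c : Space d → Space d} (hb : IsDivFree b)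
    (h : b =ᵐ[torusMeasure d] c) : IsDivFree c := by
  intro φ hφ
  rw [← hb φ hφ]
  refine integral_congr_ae ?_
  filter_upwards [h] with x hx
  rw [hx]

/-- Divergence-free fields are closed under convergence in `L^1`. -/
theorem IsDivFree.of_tendsto {b : ℕ → Space d → Space d} {c : Space d → Space d}
    (hb : ∀ n, IsDivFree (b n)) (hbi : ∀ n, Integrable (b n) (torusMeasure d))
    (hc : Integrable c (torusMeasure d))
    (h : Filter.Tendsto (fun n => eLpNorm (b n - c) 1 (torusMeasure d)) Filter.atTop (nhds 0)) :
    IsDivFree c := by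
  intro φ hφ
  obtain ⟨C, hC0, hC⟩ := exists_bound_cube hφ.continuous_gradient
  have hle : ∀ n, |∫ x, inner ℝ (c x) (gradient φ x) ∂(torusMeasure d)| ≤
      C * (eLpNorm (b n - c) 1 (torusMeasure d)).toReal := by
    intro n
    have hi := (hbi n).sub hc
    have e : ∫ x, inner ℝ (c x) (gradient φ x) ∂(torusMeasure d) =
        -∫ x, inner ℝ ((b n - c) x) (gradient φ x) ∂(torusMeasure d) := by
      simp only [Pi.sub_apply, inner_sub_left]
      rw [integral_sub (integrable_inner_of_continuous (hbi n) hφ.continuous_gradient)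
        (integrable_inner_of_continuous hc hφ.continuous_gradient), hb n φ hφ]
      ring
    rw [e, abs_neg, ← Real.norm_eq_abs, eLpNorm_one_eq_lintegral_enorm,
      ← integral_norm_eq_lintegral_enorm hi.aestronglyMeasurable, ← integral_const_mul]
    refine norm_integral_le_of_norm_le (hi.norm.const_mul C) ?_
    filter_upwards [ae_mem_cube] with x hx
    refine (norm_inner_le_norm _ _).trans ?_
    rw [mul_comm]
    gcongr
    exact hC x hx
  have h2 := ((ENNReal.tendsto_toReal ENNReal.zero_ne_top).comp h).const_mul C
  simp only [ENNReal.toReal_zero, mul_zero] at h2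
  have h3 := ge_of_tendsto' h2 hle
  exact abs_nonpos_iff.1 h3

/-! ### Oscillating profiles in one variable -/

theorem integral_intervalMeasure_eq {f : ℝ → ℝ} (hp : Function.Periodic f 1) :
    ∫ t, f t ∂intervalMeasure = ∫ t in (0 : ℝ)..1, f t := by
  rw [integral_Icc_eq_integral_Ioc, ← intervalIntegral.integral_of_le (by norm_num)]
  have := hp.intervalIntegral_add_eq (-(1 / 2)) 0
  norm_num at this ⊢
  exact this

theorem periodic_comp_nat_mul {f : ℝ → ℝ} (hp : Function.Periodic f 1) (n : ℕ) :
    Function.Periodic (fun t => f (n * t)) 1 := by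
  intro t
  simp only [mul_add, mul_one]
  simpa using hp.nat_mul n (n * t)

theorem integral_comp_nat_mul {f : ℝ → ℝ} (hp : Function.Periodic f 1) (hf : Continuous f) {n : ℕ}
    (hn : 0 < n) : ∫ t, f (n * t) ∂intervalMeasure = ∫ t, f t ∂intervalMeasure := by
  have hn' : (n : ℝ) ≠ 0 := by positivity
  rw [integral_intervalMeasure_eq (periodic_comp_nat_mul hp n), integral_intervalMeasure_eq hp,
    intervalIntegral.integral_comp_mul_left (fun t => f t) hn']
  have := hp.intervalIntegral_add_zsmul_eq n 0 (fun a b => hf.intervalIntegrable a b)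
  simp only [zero_add, zsmul_eq_mul, Int.cast_natCast, mul_one] at this
  simp [this, hn']

/-- A smooth nonnegative periodic profile minus its mean has, after rescaling by `n`, a periodic
primitive of size `1 / n`. -/
theorem exists_oscillating_primitive {ω : ℝ → ℝ} (hω : ContDiff ℝ (⊤ : ℕ∞) ω)
    (hp : Function.Periodic ω 1) (h0 : ∀ t, 0 ≤ ω t) {n : ℕ} (hn : 0 < n) :
    ∃ H : ℝ → ℝ, ContDiff ℝ (⊤ : ℕ∞) H ∧ Function.Periodic H 1 ∧
      (∀ t, deriv H t = ω (n * t) - ∫ t, ω t ∂intervalMeasure) ∧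
      ∀ t, |H t| ≤ (∫ t, ω t ∂intervalMeasure) / n := by
  set m := ∫ t, ω t ∂intervalMeasure with hm
  have hm' : m = ∫ t in (0 : ℝ)..1, ω t := integral_intervalMeasure_eq hp
  set G : ℝ → ℝ := fun t => ∫ s in (0 : ℝ)..t, (ω s - m) with hG
  have hc : Continuous fun s => ω s - m := hω.continuous.sub continuous_const
  have hGd : ∀ t, HasDerivAt G (ω t - m) t := fun t =>
    intervalIntegral.integral_hasDerivAt_right (hc.intervalIntegrable _ _)
      (hc.stronglyMeasurableAtFilter _ _) hc.continuousAt
  have hGs : ContDiff ℝ (⊤ : ℕ∞) G := by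
    rw [contDiff_infty_iff_deriv]
    refine ⟨fun t => (hGd t).differentiableAt, ?_⟩
    rw [show deriv G = fun t => ω t - m from funext fun t => (hGd t).deriv]
    exact hω.sub contDiff_const
  have hGp : Function.Periodic G 1 := by
    intro t
    have hpp : Function.Periodic (fun s => ω s - m) 1 := fun s => by simp only [hp s]
    have h1 := hpp.intervalIntegral_add_eq t 0
    have h2 : ∫ s in (0 : ℝ)..(0 + 1), (ω s - m) = 0 := by
      rw [intervalIntegral.integral_sub (hω.continuous.intervalIntegrable _ _) (by simp)]
      simp [← hm']
    rw [h2] at h1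
    simp only [hG]
    rw [← intervalIntegral.integral_add_adjacent_intervals (hc.intervalIntegrable 0 t)
      (hc.intervalIntegrable t (t + 1)), h1, add_zero]
  have hm0 : 0 ≤ m := integral_nonneg h0
  -- As ω ≥ 0, on one period G(s) is the difference of ∫₀ˢ ω and s m, both in [0, m]. The bound
  -- involves only the mean of ω and not its concentration; this is what later allows the frequency
  -- to be fixed before the concentration parameter.
  have hGb : ∀ t, |G t| ≤ m := by
    intro t
    have h1 : G t = G (Int.fract t) := by
      have := hGp.sub_int_mul_eq (x := t) ⌊t⌋
      rw [mul_one] at this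
      rw [← this]; rfl
    rw [h1]
    have hs0 := Int.fract_nonneg t
    have hs1 := (Int.fract_lt_one t).le
    set s := Int.fract t
    have h2 : G s = (∫ r in (0 : ℝ)..s, ω r) - s * m := by
      simp only [hG]
      rw [intervalIntegral.integral_sub (hω.continuous.intervalIntegrable _ _) (by simp)]
      simp
    have h3 : 0 ≤ ∫ r in (0 : ℝ)..s, ω r := intervalIntegral.integral_nonneg hs0 fun r _ => h0 r
    have h4 : ∫ r in (0 : ℝ)..s, ω r ≤ m := by
      rw [hm', ← intervalIntegral.integral_add_adjacent_intervals
        (hω.continuous.intervalIntegrable 0 s) (hω.continuous.intervalIntegrable s 1)]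
      have := intervalIntegral.integral_nonneg (μ := volume) hs1 fun r _ => h0 r
      linarith
    rw [h2, abs_le]
    constructor <;> nlinarith
  have hn' : (0 : ℝ) < n := by positivity
  refine ⟨fun t => G (n * t) / n, (hGs.comp (by fun_prop)).div_const _, fun t => ?_, fun t => ?_,
    fun t => ?_⟩
  · simp only [periodic_comp_nat_mul hGp n t]
  · have h1 : HasDerivAt (fun t : ℝ => (n : ℝ) * t) n t := by
      simpa using (hasDerivAt_id t).const_mul (n : ℝ)
    have := ((hGd (n * t)).comp t h1).div_const (n : ℝ)
    rw [HasDerivAt.deriv (f := fun t => G (n * t) / n) this]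
    field_simp
  · rw [abs_div, abs_of_pos hn']
    gcongr
    exact hGb _

/-! ### Product profiles -/

/-- The product profile `∏_{k ∈ S} w (x_k)`. -/
def prodProfile (w : ℝ → ℝ) (S : Finset (Fin d)) (x : Space d) : ℝ := ∏ k ∈ S, w (x k)

section ProdProfile

variable {w : ℝ → ℝ}

theorem isTest_prodProfile (hw : ContDiff ℝ (⊤ : ℕ∞) w) (hp : Function.Periodic w 1)
    (S : Finset (Fin d)) : IsTest (prodProfile w S) :=
  IsTest.prod S fun k _ => IsTest.coord hw hp k

theorem prodProfile_insert {S : Finset (Fin d)} {k : Fin d} (hk : k ∉ S) :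
    (prodProfile w (insert k S) : Space d → ℝ) = fun x => w (x k) * prodProfile w S x := by
  funext x; simp [prodProfile, Finset.prod_insert hk]

theorem prodProfile_nonneg (h0 : ∀ t, 0 ≤ w t) (S : Finset (Fin d)) (x : Space d) :
    0 ≤ prodProfile w S x := Finset.prod_nonneg fun _ _ => h0 _

theorem prodProfile_pos (h0 : ∀ t, 0 < w t) (S : Finset (Fin d)) (x : Space d) :
    0 < prodProfile w S x := Finset.prod_pos fun _ _ => h0 _

theorem prodProfile_rpow (h0 : ∀ t, 0 ≤ w t) (S : Finset (Fin d)) (x : Space d) (s : ℝ) :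
    prodProfile w S x ^ s = prodProfile (fun t => w t ^ s) S x :=
  (Real.finsetProd_rpow S _ (fun _ _ => h0 _) s).symm

theorem integral_prodProfile (w : ℝ → ℝ) (S : Finset (Fin d)) :
    ∫ x, prodProfile w S x ∂(torusMeasure d) = (∫ t, w t ∂intervalMeasure) ^ S.card := by
  have h := integral_prod_coord (d := d) fun k t => if k ∈ S then w t else 1
  have e (x : Space d) : ∏ k, (if k ∈ S then w (x k) else 1) = prodProfile w S x := by
    simp [prodProfile, Finset.prod_ite_mem]
  simp only [e] at h
  rw [h]
  have e2 (k : Fin d) : ∫ t, (if k ∈ S then w t else 1) ∂intervalMeasure =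
      if k ∈ S then ∫ t, w t ∂intervalMeasure else 1 := by
    split_ifs <;> simp
  simp only [e2]
  rw [Finset.prod_ite_mem]
  simp

theorem pd_prodProfile_of_notMem (hw : ContDiff ℝ (⊤ : ℕ∞) w) (hp : Function.Periodic w 1)
    {S : Finset (Fin d)} {i : Fin d} (hi : i ∉ S) (x : Space d) :
    pd i (prodProfile w S) x = 0 := by
  induction S using Finset.induction_on with
  | empty =>
    have : (prodProfile w ∅ : Space d → ℝ) = fun _ => 1 := by funext x; simp [prodProfile]
    simp [this, pd]
  | insert k S hk ih =>
    rw [Finset.mem_insert, not_or] at hi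
    rw [prodProfile_insert hk, pd_mul (IsTest.coord hw hp k) (isTest_prodProfile hw hp S),
      ih hi.2, pd_coord (hw.differentiable (by simp))]
    simp [Ne.symm hi.1]

theorem pd_coord_mul_prodProfile {H : ℝ → ℝ} (hw : ContDiff ℝ (⊤ : ℕ∞) w)
    (hp : Function.Periodic w 1) (hH : ContDiff ℝ (⊤ : ℕ∞) H) (hHp : Function.Periodic H 1)
    {S : Finset (Fin d)} {k : Fin d} (i : Fin d) (hi : i ∉ S) (x : Space d) :
    pd i (fun y => H (y k) * prodProfile w S y) x =
      (if k = i then deriv H (x k) else 0) * prodProfile w S x := by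
  rw [pd_mul (IsTest.coord hH hHp k) (isTest_prodProfile hw hp S),
    pd_prodProfile_of_notMem hw hp hi, pd_coord (hH.differentiable (by simp))]
  ring

theorem eLpNorm_eq_ofReal_integral {F : Type*} [NormedAddCommGroup F] {f : Space d → F} {q : ℝ}
    (hq : 1 ≤ q) (hf : MemLp f (ENNReal.ofReal q) (torusMeasure d)) :
    eLpNorm f (ENNReal.ofReal q) (torusMeasure d) =
      ENNReal.ofReal ((∫ x, ‖f x‖ ^ q ∂(torusMeasure d)) ^ q⁻¹) := by
  have hq0 : 0 < q := by linarith
  rw [hf.eLpNorm_eq_integral_rpow_norm (by simpa using hq0) (by simp),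
    ENNReal.toReal_ofReal hq0.le]

theorem eLpNorm_prodProfile (hw : ContDiff ℝ (⊤ : ℕ∞) w) (hp : Function.Periodic w 1)
    (h0 : ∀ t, 0 ≤ w t) (S : Finset (Fin d)) {q : ℝ} (hq : 1 ≤ q)
    (hint : ∫ t, w t ^ q ∂intervalMeasure = 1) :
    eLpNorm (prodProfile w S) (ENNReal.ofReal q) (torusMeasure d) = 1 := by
  rw [eLpNorm_eq_ofReal_integral hq
    (memLp_of_continuous (isTest_prodProfile hw hp S).continuous _)]
  simp only [Real.norm_of_nonneg (prodProfile_nonneg h0 S _), prodProfile_rpow h0]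
  simp [integral_prodProfile, hint]

end ProdProfile

/-- As ∂ᵢQ = 0, the field is ∂ₖ(fQ) e_i - ∂ᵢ(fQ) e_k, the divergence of a skew-symmetric tensor. It
trades the large term f ∂ₖQ e_i for terms in which Q itself appears and only f is differentiated. -/
theorem isDivFree_skew {f Q : Space d → ℝ} (hf : IsTest f) (hQ : IsTest Q) {i k : Fin d}
    (hi : ∀ x, pd i Q x = 0) :
    IsDivFree (fun x => (f x * pd k Q x) • (EuclideanSpace.single i 1 : Space d) -
      (Q x • (pd i f x • (EuclideanSpace.single k 1 : Space d) -
        pd k f x • (EuclideanSpace.single i 1 : Space d)))) := by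
  intro φ hφ
  have e (x : Space d) : inner ℝ ((f x * pd k Q x) • (EuclideanSpace.single i 1 : Space d) -
      (Q x • (pd i f x • (EuclideanSpace.single k 1 : Space d) -
        pd k f x • (EuclideanSpace.single i 1 : Space d)))) (gradient φ x) =
      pd k Q x * (f x * pd i φ x) + Q x * (pd k f x * pd i φ x) - Q x * (pd i f x * pd k φ x) := by
    simp only [inner_sub_left, inner_smul_left, EuclideanSpace.inner_single_left, gradient_apply]
    simp; ring
  simp only [e]
  have t1 := (hf.mul (hφ.pd i))
  have t2 := (hf.mul (hφ.pd k))
  have h1 := integral_mul_pd hQ t1 k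
  have h2 := integral_mul_pd hQ t2 i
  simp only [hi, zero_mul, integral_zero, neg_zero] at h2
  simp only [pd_mul hf (hφ.pd _), mul_add] at h1 h2
  rw [integral_add (hQ.mul ((hf.pd _).mul (hφ.pd _))).integrable
    (hQ.mul (hf.mul ((hφ.pd _).pd _))).integrable] at h1 h2
  simp only [pd_comm hφ i k] at h2
  rw [integral_sub (((hQ.pd _).mul t1).add (hQ.mul ((hf.pd _).mul (hφ.pd _)))).integrable
    (hQ.mul ((hf.pd _).mul (hφ.pd _))).integrable,
    integral_add ((hQ.pd _).mul t1).integrable (hQ.mul ((hf.pd _).mul (hφ.pd _))).integrable]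
  linarith

theorem eLpNorm_le_const_mul {F G : Type*} [NormedAddCommGroup F] [NormedAddCommGroup G]
    {f : Space d → F} {g : Space d → G} {c : ℝ} (q : ENNReal)
    (h : ∀ x ∈ cube d, ‖f x‖ ≤ c * ‖g x‖) :
    eLpNorm f q (torusMeasure d) ≤ ENNReal.ofReal c * eLpNorm g q (torusMeasure d) :=
  eLpNorm_le_mul_eLpNorm_of_ae_le_mul (ae_mem_cube.mono h) q

/-- A field `f P e_i` with a product profile `P` independent of `x_i` agrees, up to a
divergence-free field, with its average `m ^ #S • f e_i` up to a small error. -/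
theorem exists_divFree_corrector {w H : ℝ → ℝ} (hw : ContDiff ℝ (⊤ : ℕ∞) w)
    (hp : Function.Periodic w 1) (h0 : ∀ t, 0 ≤ w t) (hH : ContDiff ℝ (⊤ : ℕ∞) H)
    (hHp : Function.Periodic H 1) {m h : ℝ} (hm0 : 0 ≤ m) (hm1 : m ≤ 1)
    (hHd : ∀ t, deriv H t = w t - m) (hHb : ∀ t, |H t| ≤ h) {q : ℝ} (hq : 1 ≤ q)
    (hint : ∫ t, w t ^ q ∂intervalMeasure = 1) {f : Space d → ℝ} (hf : IsTest f) {K : ℝ}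
    (hK : ∀ k, ∀ x ∈ cube d, |pd k f x| ≤ K) {i : Fin d} (S : Finset (Fin d)) (hi : i ∉ S) :
    ∃ E : Space d → Space d, Continuous E ∧
      IsDivFree (fun x => (f x * prodProfile w S x) • (EuclideanSpace.single i 1 : Space d) -
        E x) ∧
      eLpNorm (fun x => E x - (m ^ S.card * f x) • (EuclideanSpace.single i 1 : Space d))
        (ENNReal.ofReal q) (torusMeasure d) ≤ ENNReal.ofReal (S.card * (2 * h * K)) := by
  have hh : 0 ≤ h := (abs_nonneg _).trans (hHb 0)
  have hK0 : 0 ≤ K := (abs_nonneg _).trans (hK i 0 (by intro j; simp))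
  induction S using Finset.induction_on with
  | empty =>
    refine ⟨fun x => f x • (EuclideanSpace.single i 1 : Space d),
      hf.continuous.smul continuous_const, ?_, ?_⟩
    · intro φ _; simp [prodProfile]
    · simp
  | insert k S hk ih =>
    rw [Finset.mem_insert, not_or] at hi
    obtain ⟨E, hEc, hE, hEn⟩ := ih hi.2
    have hQ : IsTest fun y : Space d => H (y k) * prodProfile w S y :=
      (IsTest.coord hH hHp k).mul (isTest_prodProfile hw hp S)
    -- The factor w(x_k) is split as m + (w(x_k) - m). The first part is covered by the induction
    -- hypothesis. In the second, (w(x_k) - m) P = ∂ₖ(H(x_k) P) for the remaining product P, so by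
    -- `isDivFree_skew` it may be replaced by A, whose size is governed by |H| ≤ h.
    set A : Space d → Space d := fun x => (H (x k) * prodProfile w S x) •
      (pd i f x • (EuclideanSpace.single k 1 : Space d) -
        pd k f x • (EuclideanSpace.single i 1 : Space d)) with hA
    have hAc : Continuous A := by
      refine hQ.continuous.smul ?_
      exact ((hf.pd i).continuous.smul continuous_const).sub
        ((hf.pd k).continuous.smul continuous_const)
    have hskew := isDivFree_skew hf hQ (i := i) (k := k) fun x => by
      rw [pd_coord_mul_prodProfile hw hp hH hHp i hi.2, if_neg (Ne.symm hi.1), zero_mul]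
    have hpk (x : Space d) : pd k (fun y : Space d => H (y k) * prodProfile w S y) x =
        (w (x k) - m) * prodProfile w S x := by
      rw [pd_coord_mul_prodProfile hw hp hH hHp k hk, if_pos rfl, hHd]
    simp only [hpk] at hskew
    refine ⟨fun x => m • E x + A x, (hEc.const_smul m).add hAc, ?_, ?_⟩
    · have hP := (isTest_prodProfile hw hp S).continuous
      have hwc : Continuous fun x : Space d => w (x k) := hw.continuous.comp (by fun_prop)
      have := (hE.const_smul m).add hskew
        (integrable_of_continuous (((((hf.continuous.mul hP).smul continuous_const).sub
          hEc)).const_smul m))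
        (integrable_of_continuous (((hf.continuous.mul ((hwc.sub continuous_const).mul hP)).smul
          continuous_const).sub hAc))
      convert this using 1
      funext x
      simp only [prodProfile_insert hk, hA]
      module
    · have hc : Continuous fun x => E x -
          (m ^ S.card * f x) • (EuclideanSpace.single i 1 : Space d) :=
        hEc.sub ((continuous_const.mul hf.continuous).smul continuous_const)
      have e : (fun x => m • E x + A x - (m ^ (insert k S).card * f x) •
          (EuclideanSpace.single i 1 : Space d)) =
          (m • fun x => E x - (m ^ S.card * f x) • (EuclideanSpace.single i 1 : Space d)) + A := by
        funext x
        simp only [Pi.add_apply, Pi.smul_apply, Finset.card_insert_of_notMem hk, pow_succ]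
        module
      rw [e]
      refine (eLpNorm_add_le (hc.const_smul m).aestronglyMeasurable hAc.aestronglyMeasurable
        (by simpa using hq)).trans ?_
      rw [Finset.card_insert_of_notMem hk, eLpNorm_const_smul]
      have h1 : eLpNorm A (ENNReal.ofReal q) (torusMeasure d) ≤ ENNReal.ofReal (2 * h * K) := by
        have := eLpNorm_le_const_mul (f := A) (g := prodProfile w S) (c := 2 * h * K)
          (ENNReal.ofReal q) (fun x hx => by
            simp only [hA, norm_smul, norm_mul, Real.norm_eq_abs]
            have := (norm_sub_le (pd i f x • (EuclideanSpace.single k 1 : Space d))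
              (pd k f x • (EuclideanSpace.single i 1 : Space d)))
            simp only [norm_smul, PiLp.norm_single, Real.norm_eq_abs, abs_one,
              mul_one] at this
            calc _ ≤ (h * |prodProfile w S x|) * (K + K) := by
                  gcongr
                  · exact hHb _
                  · exact this.trans (add_le_add (hK i x hx) (hK k x hx))
              _ = _ := by ring)
        rwa [eLpNorm_prodProfile hw hp h0 S hq hint, mul_one] at this
      -- Since m ≤ 1, earlier errors are not amplified, and each factor adds one more 2hK; the
      -- remaining product has norm one in L^q.
      calc _ ≤ 1 * ENNReal.ofReal (S.card * (2 * h * K)) + ENNReal.ofReal (2 * h * K) := by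
            gcongr
            rw [Real.enorm_eq_ofReal hm0]
            exact ENNReal.ofReal_le_one.2 hm1
        _ = _ := by
            rw [one_mul, ← ENNReal.ofReal_add (by positivity) (by positivity)]
            push_cast; ring_nf

/-- Product profiles of mean one average out against a fixed test function. -/
theorem abs_integral_mul_prodProfile_sub_le {w H : ℝ → ℝ} (hw : ContDiff ℝ (⊤ : ℕ∞) w)
    (hp : Function.Periodic w 1) (h0 : ∀ t, 0 ≤ w t) (hH : ContDiff ℝ (⊤ : ℕ∞) H)
    (hHp : Function.Periodic H 1) {h : ℝ}
    (hHd : ∀ t, deriv H t = w t - 1) (hHb : ∀ t, |H t| ≤ h)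
    (hint : ∫ t, w t ∂intervalMeasure = 1) {a : Space d → ℝ} (ha : IsTest a) {K : ℝ}
    (hK : ∀ k, ∀ x ∈ cube d, |pd k a x| ≤ K) (S : Finset (Fin d)) :
    |∫ x, a x * prodProfile w S x ∂(torusMeasure d) - ∫ x, a x ∂(torusMeasure d)| ≤
      S.card * (h * K) := by
  have hh : 0 ≤ h := (abs_nonneg _).trans (hHb 0)
  induction S using Finset.induction_on with
  | empty => simp [prodProfile]
  | insert k S hk ih =>
    have hP := isTest_prodProfile (d := d) hw hp S
    have hQ : IsTest fun y : Space d => H (y k) * prodProfile w S y :=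
      (IsTest.coord hH hHp k).mul hP
    -- The oscillation w(x_k) - 1 is H'(x_k). Integration by parts puts the derivative on a and
    -- leaves H, of size h, against a product of mean one.
    have h1 := integral_mul_pd ha hQ k
    simp only [pd_coord_mul_prodProfile hw hp hH hHp k hk, if_true, hHd] at h1
    have e : ∫ x, a x * prodProfile w (insert k S) x ∂(torusMeasure d) =
        ∫ x, a x * prodProfile w S x ∂(torusMeasure d) +
        ∫ x, a x * ((w (x k) - 1) * prodProfile w S x) ∂(torusMeasure d) := by
      rw [← integral_add (ha.mul hP).integrable
        (ha.mul (((IsTest.coord hw hp k).sub (IsTest.const 1)).mul hP)).integrable]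
      refine integral_congr_ae (Filter.Eventually.of_forall fun x => ?_)
      simp only [prodProfile_insert hk]; ring
    have h2 : |∫ x, pd k a x * (H (x k) * prodProfile w S x) ∂(torusMeasure d)| ≤ h * K := by
      have := norm_integral_le_of_norm_le (μ := torusMeasure d)
        (f := fun x => pd k a x * (H (x k) * prodProfile w S x))
        (g := fun x => h * K * prodProfile w S x) (hP.integrable.const_mul _) (by
          filter_upwards [ae_mem_cube] with x hx
          rw [Real.norm_eq_abs, abs_mul, abs_mul, abs_of_nonneg (prodProfile_nonneg h0 S x)]
          calc _ ≤ K * (h * prodProfile w S x) := by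
                have hK0 : 0 ≤ K := (abs_nonneg _).trans (hK k x hx)
                have := prodProfile_nonneg h0 S x
                gcongr
                · exact hK k x hx
                · exact hHb _
            _ = _ := by ring)
      rwa [integral_const_mul, integral_prodProfile, hint, one_pow, mul_one] at this
    rw [e, h1, Finset.card_insert_of_notMem hk]
    push_cast
    calc _ ≤ |∫ x, a x * prodProfile w S x ∂(torusMeasure d) - ∫ x, a x ∂(torusMeasure d)| +
          |∫ x, pd k a x * (H (x k) * prodProfile w S x) ∂(torusMeasure d)| := by
          rw [← sub_eq_add_neg, sub_right_comm]; exact abs_sub _ _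
      _ ≤ _ := by linarith

/-! ### Density of test functions in `L^1` -/

/-- The lattice point nearest to `x`. -/
def nearestLattice (x : Space d) : Space d := WithLp.toLp 2 fun j => (round (x j) : ℝ)

theorem round_eq_of_abs_sub_lt {x : ℝ} {n : ℤ} (h : |x - n| < 1 / 2) : round x = n := by
  rw [round_eq, Int.floor_eq_iff]
  rw [abs_lt] at h
  constructor <;> linarith

/-- The nearest lattice point jumps only where a coordinate of x is a half-integer, and near such x
the function vanishes because r < 1/2. Elsewhere it is locally a translate of h. -/
theorem isTest_periodization {h : Space d → ℝ} (hh : ContDiff ℝ (⊤ : ℕ∞) h) {r : ℝ}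
    (hr : r < 1 / 2) (h0 : ∀ x : Space d, ∀ j, r ≤ |x j| → h x = 0) :
    IsTest fun x => h (x - nearestLattice x) := by
  constructor
  · rw [contDiff_iff_contDiffAt]
    intro x
    by_cases hx : ∀ j, |x j - round (x j)| < 1 / 2
    · have hopen : IsOpen {z : Space d | ∀ j, |z j - round (x j)| < 1 / 2} := by
        simp only [Set.ofPred_forall]
        exact isOpen_iInter_of_finite fun j => isOpen_lt (by fun_prop) continuous_const
      have hev : (fun z => h (z - nearestLattice z)) =ᶠ[nhds x]
          fun z => h (z - nearestLattice x) := by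
        filter_upwards [hopen.mem_nhds hx] with z hz
        have : nearestLattice z = nearestLattice x := by
          ext j; simp only [nearestLattice]
          rw [round_eq_of_abs_sub_lt (hz j)]
        rw [this]
      exact (hh.comp (contDiff_id.sub contDiff_const)).contDiffAt.congr_of_eventuallyEq hev
    · push Not at hx
      obtain ⟨j, hj⟩ := hx
      have hopen : IsOpen {z : Space d | |z j - x j| < 1 / 2 - r} :=
        isOpen_lt (by fun_prop) continuous_const
      have hev : (fun z => h (z - nearestLattice z)) =ᶠ[nhds x] fun _ => 0 := by
        filter_upwards [hopen.mem_nhds (by simp; linarith)] with z hz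
        refine h0 _ j ?_
        have h1 := round_le (x j) (round (z j))
        have h2 := abs_sub_le (x j) (z j) (round (z j))
        rw [abs_sub_comm (x j) (z j)] at h2
        have h3 : |z j - x j| < 1 / 2 - r := hz
        simp only [nearestLattice, PiLp.sub_apply]
        linarith
      exact contDiffAt_const.congr_of_eventuallyEq hev
  · intro x i
    congr 1
    ext j
    simp only [nearestLattice, PiLp.sub_apply, PiLp.add_apply]
    by_cases hij : j = i
    · subst hij; simp
    · simp [hij]

theorem ae_mem_openCube : ∀ᵐ x ∂(torusMeasure d), ∀ j, |x j| < 1 / 2 := by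
  have h1 : ∀ᵐ x ∂(torusMeasure d), ∀ j, x j ≠ 1 / 2 ∧ x j ≠ -(1 / 2) := by
    rw [torusMeasure_eq_map, (MeasurableEquiv.measurableEmbedding _).ae_map_iff, ae_all_iff]
    intro j
    have hn (c : ℝ) : ∀ᵐ y ∂(Measure.pi fun _ : Fin d => intervalMeasure), y j ≠ c :=
      Measure.ae_eval_ne (μ := fun _ : Fin d => intervalMeasure) j c
    filter_upwards [hn (1 / 2), hn (-(1 / 2))] with y hy hy'
    exact ⟨hy, hy'⟩
  filter_upwards [h1, ae_mem_cube] with x hx hc j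
  have := hc j
  rw [abs_lt]
  exact ⟨lt_of_le_of_ne this.1 (hx j).2.symm, lt_of_le_of_ne this.2 (hx j).1⟩

/-- Smooth approximations on ℝ^d need not be periodic. They are cut off near the faces of the cube,
at a cost that vanishes by dominated convergence, and then periodized; inside the open cube
periodization changes nothing. -/
theorem exists_isTest_eLpNorm_sub_le {f : Space d → ℝ} (hf : Integrable f (torusMeasure d))
    {δ : ℝ} (hδ : 0 < δ) :
    ∃ g, IsTest g ∧ eLpNorm (f - g) 1 (torusMeasure d) ≤ ENNReal.ofReal δ := by
  obtain ⟨g, -, hg, hfg⟩ := (memLp_one_iff_integrable.2 hf).exist_eLpNorm_sub_le (by simp) le_rfl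
    (half_pos hδ)
  let s : ℕ → ℝ := fun n => 1 / (8 * ((n : ℝ) + 1))
  have hs0 (n) : 0 < s n := by positivity
  have hs1 (n) : s n ≤ 1 / 8 := by
    simp only [s]
    rw [div_le_div_iff₀ (by positivity) (by norm_num)]
    nlinarith [(Nat.cast_nonneg n : (0 : ℝ) ≤ n)]
  have hst : Filter.Tendsto s Filter.atTop (nhds 0) := by
    have := (tendsto_one_div_add_atTop_nhds_zero_nat (𝕜 := ℝ)).const_mul (1 / 8)
    rw [mul_zero] at this
    refine this.congr fun n => ?_
    simp only [s]; field_simp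
  -- The cutoff equals one up to distance 2 s n from the faces and vanishes within distance s n of
  -- them; s n ≤ 1/8 keeps the inner radius positive.
  let c : ∀ n, ContDiffBump (0 : ℝ) := fun n =>
    { rIn := 1 / 2 - 2 * s n
      rOut := 1 / 2 - s n
      rIn_pos := by linarith [hs1 n]
      rIn_lt_rOut := by linarith [hs0 n] }
  let h : ℕ → Space d → ℝ := fun n x => g x * ∏ j, c n (x j)
  have hh (n) : ContDiff ℝ (⊤ : ℕ∞) (h n) :=
    hg.mul (contDiff_prod fun j _ => (c n).contDiff.comp (by fun_prop))
  have hz (n) (x : Space d) (j) (hj : 1 / 2 - s n ≤ |x j|) : h n x = 0 := by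
    have : c n (x j) = 0 := (c n).zero_of_le_dist (by
      rw [dist_zero_right]; exact hj)
    simp only [h]
    rw [Finset.prod_eq_zero (Finset.mem_univ j) this, mul_zero]
  have hT (n) : IsTest fun x => h n (x - nearestLattice x) :=
    isTest_periodization (hh n) (by linarith [hs0 n]) (hz n)
  obtain ⟨C, hC0, hC⟩ := exists_bound_cube hg.continuous
  have hlim : Filter.Tendsto (fun n => ∫ x, ‖g x - h n x‖ ∂(torusMeasure d)) Filter.atTop
      (nhds (∫ x, (0 : ℝ) ∂(torusMeasure d))) := by
    refine tendsto_integral_of_dominated_convergence (fun _ => C)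
      (fun n => (hg.continuous.sub (hh n).continuous).norm.aestronglyMeasurable)
      (integrable_const _) (fun n => ?_) ?_
    · filter_upwards [ae_mem_cube] with x hx
      have e : g x - h n x = g x * (1 - ∏ j, c n (x j)) := by simp only [h]; ring
      have p0 : 0 ≤ ∏ j, c n (x j) := Finset.prod_nonneg fun _ _ => (c n).nonneg
      have p1 : ∏ j, c n (x j) ≤ 1 := Finset.prod_le_one (fun _ _ => (c n).nonneg)
        fun _ _ => (c n).le_one
      rw [norm_norm, e, norm_mul, Real.norm_of_nonneg (by linarith : 0 ≤ 1 - ∏ j, c n (x j))]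
      calc _ ≤ C * 1 := by gcongr; exact hC x hx; linarith
        _ = C := mul_one C
    · filter_upwards [ae_mem_openCube] with x hx
      have hev : ∀ᶠ n in Filter.atTop, ∀ j, 2 * s n < 1 / 2 - |x j| := by
        rw [Filter.eventually_all]
        intro j
        have := hst.const_mul 2
        rw [mul_zero] at this
        exact this.eventually (gt_mem_nhds (by linarith [hx j]))
      refine tendsto_const_nhds.congr' ?_
      filter_upwards [hev] with n hn
      have : ∏ j, c n (x j) = 1 := Finset.prod_eq_one fun j _ =>
        (c n).one_of_mem_closedBall (by
          simp only [Metric.mem_closedBall, dist_zero_right, Real.norm_eq_abs, c]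
          linarith [hn j])
      simp [h, this]
  rw [integral_zero] at hlim
  obtain ⟨n, hn⟩ := (hlim.eventually (gt_mem_nhds (half_pos hδ))).exists
  refine ⟨_, hT n, ?_⟩
  have hcong : (fun x => h n (x - nearestLattice x)) =ᵐ[torusMeasure d] h n := by
    filter_upwards [ae_mem_openCube] with x hx
    have : nearestLattice x = 0 := by
      ext j
      have : round (x j) = 0 := round_eq_of_abs_sub_lt (by simpa using hx j)
      simp [nearestLattice, this]
    rw [this, sub_zero]
  have e : f - (fun x => h n (x - nearestLattice x)) =ᵐ[torusMeasure d] (f - g) + (g - h n) := by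
    filter_upwards [hcong] with x hx
    simp only [Pi.sub_apply, Pi.add_apply, hx]; ring
  rw [eLpNorm_congr_ae e]
  refine (eLpNorm_add_le (hf.aestronglyMeasurable.sub hg.continuous.aestronglyMeasurable)
    (hg.continuous.sub (hh n).continuous).aestronglyMeasurable le_rfl).trans ?_
  have e2 : eLpNorm (g - h n) 1 (torusMeasure d) =
      ENNReal.ofReal (∫ x, ‖g x - h n x‖ ∂(torusMeasure d)) := by
    rw [eLpNorm_one_eq_lintegral_enorm]
    exact (ofReal_integral_norm_eq_lintegral_enorm
      (integrable_of_continuous (hg.continuous.sub (hh n).continuous))).symm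
  rw [e2]
  calc _ ≤ ENNReal.ofReal (δ / 2) + ENNReal.ofReal (δ / 2) := by gcongr
    _ = _ := by rw [← ENNReal.ofReal_add (by positivity) (by positivity), add_halves]

/-! ### Concentrated profiles -/

/-- The periodic analogue of a Gaussian of width `a ^ (-1/2)`. -/
def peak (a t : ℝ) : ℝ := Real.exp (a * (Real.cos (2 * Real.pi * t) - 1))

/-- The mass of `peak a`. -/
def peakMass (a : ℝ) : ℝ := ∫ t, peak a t ∂intervalMeasure

theorem contDiff_peak (a : ℝ) : ContDiff ℝ (⊤ : ℕ∞) (peak a) := by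
  unfold peak; fun_prop

theorem peak_pos (a t : ℝ) : 0 < peak a t := Real.exp_pos _

theorem periodic_peak (a : ℝ) : Function.Periodic (peak a) 1 := by
  intro t
  simp only [peak, mul_add, mul_one, Real.cos_add_two_pi]

theorem integrable_intervalMeasure {f : ℝ → ℝ} (hf : Continuous f) :
    Integrable f intervalMeasure :=
  hf.continuousOn.integrableOn_compact isCompact_Icc

/-- Here cos(2πt) - 1 = -2 sin²(πt), and Jordan's inequality gives |sin(πt)| ≥ 2|t| on this period.
-/
theorem peak_le_gaussian {a t : ℝ} (ha : 0 ≤ a) (ht : t ∈ Set.Icc (-(1 / 2) : ℝ) (1 / 2)) :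
    peak a t ≤ Real.exp (-(8 * a) * t ^ 2) := by
  have h1 : Real.cos (2 * Real.pi * t) - 1 = -(2 * Real.sin (Real.pi * t) ^ 2) := by
    rw [Real.sin_sq_eq_half_sub]; ring_nf
  have h2 : 2 * |t| ≤ |Real.sin (Real.pi * t)| := by
    have := Real.mul_abs_le_abs_sin (x := Real.pi * t) (by
      rw [abs_mul, abs_of_pos Real.pi_pos]
      have : |t| ≤ 1 / 2 := abs_le.2 ⟨by linarith [ht.1], ht.2⟩
      nlinarith [Real.pi_pos])
    rw [abs_mul, abs_of_pos Real.pi_pos] at this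
    have e : 2 / Real.pi * (Real.pi * |t|) = 2 * |t| := by field_simp
    linarith
  have h3 : 4 * t ^ 2 ≤ Real.sin (Real.pi * t) ^ 2 := by
    rw [← sq_abs t, ← sq_abs (Real.sin _)]
    nlinarith [abs_nonneg t]
  unfold peak
  rw [h1]
  apply Real.exp_le_exp.2
  nlinarith

theorem peakMass_le {a : ℝ} (ha : 0 < a) : peakMass a ≤ a ^ (-(1 / 2) : ℝ) := by
  have hg : Integrable fun t : ℝ => Real.exp (-(8 * a) * t ^ 2) :=
    integrable_exp_neg_mul_sq (by positivity)
  calc peakMass a ≤ ∫ t, Real.exp (-(8 * a) * t ^ 2) ∂intervalMeasure := by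
        refine integral_mono_ae (integrable_intervalMeasure (contDiff_peak a).continuous)
          hg.restrict ?_
        filter_upwards [ae_restrict_mem measurableSet_Icc] with t ht
        exact peak_le_gaussian ha.le ht
    _ ≤ ∫ t : ℝ, Real.exp (-(8 * a) * t ^ 2) :=
        setIntegral_le_integral hg (Filter.Eventually.of_forall fun t => (Real.exp_pos _).le)
    _ = Real.sqrt (Real.pi / (8 * a)) := integral_gaussian _
    _ ≤ Real.sqrt (a⁻¹) := by
        apply Real.sqrt_le_sqrt
        rw [div_le_iff₀ (by positivity)]
        have : a⁻¹ * (8 * a) = 8 := by field_simp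
        rw [this]; linarith [Real.pi_le_four]
    _ = _ := by rw [Real.sqrt_eq_rpow, Real.inv_rpow ha.le, Real.rpow_neg ha.le]

/-- On the interval of length a^(-1/2) around 0 the exponent is at least -π²/2, because cos x ≥ 1 -
x²/2. -/
theorem le_peakMass {a : ℝ} (ha : 1 ≤ a) :
    Real.exp (-(Real.pi ^ 2 / 2)) * a ^ (-(1 / 2) : ℝ) ≤ peakMass a := by
  have ha0 : 0 < a := by linarith
  set r := a ^ (-(1 / 2) : ℝ) with hr
  have hr0 : 0 < r := by positivity
  have hr1 : r ≤ 1 := Real.rpow_le_one_of_one_le_of_nonpos ha (by norm_num)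
  have hr2 : a * r ^ 2 = 1 := by
    rw [hr, ← Real.rpow_natCast, ← Real.rpow_mul ha0.le]
    norm_num
    rw [Real.rpow_neg_one]; field_simp
  have hsub : Set.Icc (-(r / 2)) (r / 2) ⊆ Set.Icc (-(1 / 2) : ℝ) (1 / 2) :=
    Set.Icc_subset_Icc (by linarith) (by linarith)
  calc _ = ∫ _ in Set.Icc (-(r / 2)) (r / 2), Real.exp (-(Real.pi ^ 2 / 2)) := by
        rw [setIntegral_const, Real.volume_real_Icc_of_le (by linarith)]
        simp; ring
    _ ≤ ∫ t in Set.Icc (-(r / 2)) (r / 2), peak a t := by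
        refine setIntegral_mono_on (by simp) ((contDiff_peak a).continuous.continuousOn.integrableOn_compact
          isCompact_Icc) measurableSet_Icc fun t ht => ?_
        apply Real.exp_le_exp.2
        have h1 := Real.one_sub_sq_div_two_le_cos (x := 2 * Real.pi * t)
        have h2 : t ^ 2 ≤ (r / 2) ^ 2 := sq_le_sq' ht.1 ht.2
        have h3 : a * t ^ 2 ≤ 1 / 4 := by nlinarith
        have h4 : a * (1 - (2 * Real.pi * t) ^ 2 / 2 - 1) ≤
            a * (Real.cos (2 * Real.pi * t) - 1) := by gcongr
        nlinarith [sq_nonneg Real.pi]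
    _ ≤ _ := setIntegral_mono_set (integrable_intervalMeasure (contDiff_peak a).continuous)
          (Filter.Eventually.of_forall fun t => (peak_pos a t).le) hsub.eventuallyLE

theorem peakMass_pos {a : ℝ} (ha : 1 ≤ a) : 0 < peakMass a :=
  lt_of_lt_of_le (by positivity) (le_peakMass ha)

/-- The normalised peak at scale `n + 1`. -/
def profile (n : ℕ) (t : ℝ) : ℝ := peak (n + 1) t / peakMass (n + 1)

theorem one_le_nat_add_one (n : ℕ) : (1 : ℝ) ≤ (n : ℝ) + 1 := by
  linarith [(Nat.cast_nonneg n : (0 : ℝ) ≤ n)]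

theorem profile_pos (n : ℕ) (t : ℝ) : 0 < profile n t :=
  div_pos (peak_pos _ _) (peakMass_pos (one_le_nat_add_one n))

theorem contDiff_profile (n : ℕ) : ContDiff ℝ (⊤ : ℕ∞) (profile n) :=
  (contDiff_peak _).div_const _

theorem periodic_profile (n : ℕ) : Function.Periodic (profile n) 1 := fun t => by
  simp only [profile, periodic_peak _ t]

theorem integral_profile (n : ℕ) : ∫ t, profile n t ∂intervalMeasure = 1 := by
  unfold profile
  rw [integral_div]
  exact div_self (peakMass_pos (one_le_nat_add_one n)).ne'

/-- A power of a peak is again a peak, with parameter multiplied by the exponent. All integrals of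
powers therefore reduce to `peakMass`, and positivity of the peak keeps every real power smooth. -/
theorem profile_rpow (n : ℕ) (s t : ℝ) :
    profile n t ^ s = peak (s * (n + 1)) t * (peakMass (n + 1) ^ s)⁻¹ := by
  rw [profile, Real.div_rpow (peak_pos _ _).le (peakMass_pos (one_le_nat_add_one n)).le,
    div_eq_mul_inv]
  congr 1
  unfold peak
  rw [← Real.exp_mul]
  congr 1
  ring

theorem inv_peakMass_rpow_le {s : ℝ} (hs : 0 ≤ s) (n : ℕ) :
    (peakMass (n + 1) ^ s)⁻¹ ≤ (Real.exp (-(Real.pi ^ 2 / 2)) ^ s)⁻¹ * ((n : ℝ) + 1) ^ (s / 2) := by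
  have h := le_peakMass (one_le_nat_add_one n)
  have hn : (0 : ℝ) < (n : ℝ) + 1 := by positivity
  have h2 := Real.rpow_le_rpow (by positivity) h hs
  rw [Real.mul_rpow (by positivity) (by positivity), ← Real.rpow_mul hn.le] at h2
  have h3 := inv_anti₀ (by positivity) h2
  rw [mul_inv, ← Real.rpow_neg hn.le] at h3
  rwa [show -(-(1 / 2) * s) = s / 2 by ring] at h3

/-- The peak of parameter s(n+1) has mass of order (n+1)^(-1/2), and the normalisation contributes
(n+1)^(s/2). For s < 1 the total exponent is negative: concentration destroys every power below the
first. -/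
theorem exists_integral_profile_rpow_le {s : ℝ} (hs : 0 < s) :
    ∃ K : ℝ, 0 ≤ K ∧ ∀ n, ∫ t, profile n t ^ s ∂intervalMeasure ≤
      K * ((n : ℝ) + 1) ^ ((s - 1) / 2) := by
  refine ⟨s ^ (-(1 / 2) : ℝ) * (Real.exp (-(Real.pi ^ 2 / 2)) ^ s)⁻¹, by positivity, fun n => ?_⟩
  have hn : (0 : ℝ) < (n : ℝ) + 1 := by positivity
  simp only [profile_rpow]
  rw [integral_mul_const]
  calc _ ≤ (s * ((n : ℝ) + 1)) ^ (-(1 / 2) : ℝ) *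
        ((Real.exp (-(Real.pi ^ 2 / 2)) ^ s)⁻¹ * ((n : ℝ) + 1) ^ (s / 2)) := by
        have := (peakMass_pos (one_le_nat_add_one n)).le
        exact mul_le_mul (peakMass_le (by positivity)) (inv_peakMass_rpow_le hs.le n)
          (by positivity) (by positivity)
    _ = _ := by
        rw [Real.mul_rpow hs.le hn.le, show (s - 1) / 2 = -(1 / 2) + s / 2 by ring,
          Real.rpow_add hn]
        ring

/-- The squared derivative carries (n+1)² sin² times two copies of the peak e^(-y), where sin² is at
most a constant times y/(n+1). One copy absorbs y through y e^(-y) ≤ 1 and the other is integrated,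
which gives the exponent 1 + s - 1/2. -/
theorem exists_integral_deriv_profile_rpow_le {s : ℝ} (hs : 0 < s) :
    ∃ K : ℝ, 0 ≤ K ∧ ∀ n, ∫ t, deriv (fun r => profile n r ^ s) t ^ 2 ∂intervalMeasure ≤
      K * ((n : ℝ) + 1) ^ (1 / 2 + s) := by
  refine ⟨8 * Real.pi ^ 2 * s * (s ^ (-(1 / 2) : ℝ) *
    (Real.exp (-(Real.pi ^ 2 / 2)) ^ (2 * s))⁻¹), by positivity, fun n => ?_⟩
  have hn : (0 : ℝ) < (n : ℝ) + 1 := by positivity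
  have hM := peakMass_pos (one_le_nat_add_one n)
  have hder (t : ℝ) : deriv (fun r => profile n r ^ s) t =
      peak (s * (n + 1)) t * (s * (n + 1) * (-(Real.sin (2 * Real.pi * t) * (2 * Real.pi)))) *
        (peakMass (n + 1) ^ s)⁻¹ := by
    simp only [profile_rpow]
    have h0 : HasDerivAt (fun r : ℝ => 2 * Real.pi * r) (2 * Real.pi) t := by
      simpa using (hasDerivAt_id t).const_mul (2 * Real.pi)
    have h1 := ((((Real.hasDerivAt_cos _).comp t h0).sub_const 1).const_mul
      (s * ((n : ℝ) + 1))).exp.mul_const ((peakMass (n + 1) ^ s)⁻¹)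
    refine h1.deriv.trans ?_
    simp only [peak, Function.comp]
    ring
  have hpt (t : ℝ) : deriv (fun r => profile n r ^ s) t ^ 2 ≤
      8 * Real.pi ^ 2 * s * (n + 1) * (peakMass (n + 1) ^ (2 * s))⁻¹ * peak (s * (n + 1)) t := by
    rw [hder]
    set y := s * (n + 1) * (1 - Real.cos (2 * Real.pi * t)) with hy
    have hy0 : 0 ≤ y := by
      have := Real.cos_le_one (2 * Real.pi * t)
      have : 0 ≤ 1 - Real.cos (2 * Real.pi * t) := by linarith
      positivity
    have hpk : peak (s * (n + 1)) t = Real.exp (-y) := by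
      unfold peak; congr 1; rw [hy]; ring
    have h1 : y * Real.exp (-y) ≤ 1 := by
      rw [Real.exp_neg, ← div_eq_mul_inv, div_le_one (Real.exp_pos _)]
      linarith [Real.add_one_le_exp y]
    have h2 : Real.sin (2 * Real.pi * t) ^ 2 ≤ 2 * (1 - Real.cos (2 * Real.pi * t)) := by
      rw [Real.sin_sq]
      nlinarith [Real.cos_le_one (2 * Real.pi * t), Real.neg_one_le_cos (2 * Real.pi * t)]
    have h3 : s * (n + 1) * Real.sin (2 * Real.pi * t) ^ 2 ≤ 2 * y := by
      have : 0 ≤ s * ((n : ℝ) + 1) := by positivity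
      rw [hy]; nlinarith
    have hM2 : (peakMass (n + 1) ^ (2 * s))⁻¹ = ((peakMass (n + 1) ^ s)⁻¹) ^ 2 := by
      rw [inv_pow, ← Real.rpow_natCast, ← Real.rpow_mul hM.le]
      norm_num [mul_comm]
    rw [hpk, hM2]
    have hE := Real.exp_pos (-y)
    calc _ = 4 * Real.pi ^ 2 * s * (n + 1) * ((peakMass (n + 1) ^ s)⁻¹) ^ 2 * Real.exp (-y) *
          ((s * (n + 1) * Real.sin (2 * Real.pi * t) ^ 2) * Real.exp (-y)) := by ring
      _ ≤ 4 * Real.pi ^ 2 * s * (n + 1) * ((peakMass (n + 1) ^ s)⁻¹) ^ 2 * Real.exp (-y) *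
          2 := by
          gcongr
          nlinarith
      _ = _ := by ring
  have hcd : ContDiff ℝ (⊤ : ℕ∞) fun r => profile n r ^ s :=
    (contDiff_profile n).rpow_const_of_ne fun t => (profile_pos n t).ne'
  calc _ ≤ ∫ t, 8 * Real.pi ^ 2 * s * (n + 1) * (peakMass (n + 1) ^ (2 * s))⁻¹ *
        peak (s * (n + 1)) t ∂intervalMeasure := by
        refine integral_mono (integrable_intervalMeasure
          ((hcd.continuous_deriv (by simp)).pow 2)) ?_ hpt
        exact (integrable_intervalMeasure (contDiff_peak _).continuous).const_mul _
    _ = 8 * Real.pi ^ 2 * s * (n + 1) * (peakMass (n + 1) ^ (2 * s))⁻¹ *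
        peakMass (s * (n + 1)) := integral_const_mul _ _
    _ ≤ 8 * Real.pi ^ 2 * s * (n + 1) * ((Real.exp (-(Real.pi ^ 2 / 2)) ^ (2 * s))⁻¹ *
        ((n : ℝ) + 1) ^ (2 * s / 2)) * (s * ((n : ℝ) + 1)) ^ (-(1 / 2) : ℝ) := by
        have hp := (peakMass_pos (one_le_nat_add_one n)).le
        gcongr
        · exact integral_nonneg fun t => (peak_pos _ t).le
        · exact inv_peakMass_rpow_le (by positivity) n
        · exact peakMass_le (by positivity)
    _ = _ := by
        rw [Real.mul_rpow hs.le hn.le, show 1 / 2 + s = 1 + -(1 / 2) + s by ring,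
          Real.rpow_add hn, Real.rpow_add hn, Real.rpow_one,
          show 2 * s / 2 = s by ring]
        ring

theorem tendsto_const_mul_rpow_zero (K : ℝ) {e : ℝ} (he : e < 0) :
    Filter.Tendsto (fun n : ℕ => K * ((n : ℝ) + 1) ^ e) Filter.atTop (nhds 0) := by
  have h1 : Filter.Tendsto (fun n : ℕ => (n : ℝ) + 1) Filter.atTop Filter.atTop :=
    Filter.tendsto_atTop_add_const_right _ _ tendsto_natCast_atTop_atTop
  have h2 := ((tendsto_rpow_neg_atTop (neg_pos.2 he)).comp h1).const_mul K
  simpa using h2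

theorem tendsto_integral_profile_rpow {s : ℝ} (hs : 0 < s) (hs1 : s < 1) :
    Filter.Tendsto (fun n => ∫ t, profile n t ^ s ∂intervalMeasure) Filter.atTop (nhds 0) := by
  obtain ⟨K, -, hK⟩ := exists_integral_profile_rpow_le hs
  exact squeeze_zero (fun n => integral_nonneg fun t => (Real.rpow_pos_of_pos (profile_pos n t) _).le)
    hK (tendsto_const_mul_rpow_zero K (by linarith))

/-- The Dirichlet energy of a product of `d - 1` concentrated profiles with exponent `s` vanishes
in the limit as soon as `(d - 1) (1 / 2 - s) > 1`. -/
theorem tendsto_energy_profile {s : ℝ} (hs : 0 < s) {d : ℕ} (hd : 2 ≤ d)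
    (h : 1 < ((d : ℝ) - 1) * (1 / 2 - s)) :
    Filter.Tendsto (fun n => (∫ t, deriv (fun r => profile n r ^ s) t ^ 2 ∂intervalMeasure) *
      (∫ t, profile n t ^ (2 * s) ∂intervalMeasure) ^ (d - 2)) Filter.atTop (nhds 0) := by
  obtain ⟨K, hK0, hK⟩ := exists_integral_profile_rpow_le (s := 2 * s) (by positivity)
  obtain ⟨L, hL0, hL⟩ := exists_integral_deriv_profile_rpow_le hs
  have hX (n) : 0 ≤ ∫ t, profile n t ^ (2 * s) ∂intervalMeasure :=
    integral_nonneg fun t => (Real.rpow_pos_of_pos (profile_pos n t) _).le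
  have hY (n) : 0 ≤ ∫ t, deriv (fun r => profile n r ^ s) t ^ 2 ∂intervalMeasure :=
    integral_nonneg fun t => sq_nonneg _
  refine squeeze_zero (fun n => mul_nonneg (hY n) (pow_nonneg (hX n) _)) (fun n => ?_)
    (tendsto_const_mul_rpow_zero (L * K ^ (d - 2))
      (e := 1 + ((d : ℝ) - 1) * (s - 1 / 2)) (by linarith))
  have hn : (0 : ℝ) < (n : ℝ) + 1 := by positivity
  -- The differentiated direction contributes the exponent 1/2 + s and each of the other d - 2
  -- directions s - 1/2, in total 1 + (d-1)(s - 1/2) < 0.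
  calc _ ≤ (L * ((n : ℝ) + 1) ^ (1 / 2 + s)) * (K * ((n : ℝ) + 1) ^ ((2 * s - 1) / 2)) ^ (d - 2) :=
        mul_le_mul (hL n) (pow_le_pow_left₀ (hX n) (hK n) _) (pow_nonneg (hX n) _) (by positivity)
    _ = _ := by
        rw [mul_pow, ← Real.rpow_natCast (((n : ℝ) + 1) ^ _), ← Real.rpow_mul hn.le,
          show 1 + ((d : ℝ) - 1) * (s - 1 / 2) =
            (1 / 2 + s) + (2 * s - 1) / 2 * ((d - 2 : ℕ) : ℝ) by
              rw [Nat.cast_sub hd]; push_cast; ring,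
          Real.rpow_add hn (1 / 2 + s)]
        ring

/-! ### Concentrated perturbations -/

theorem eLpNorm_two_eq_ofReal_sqrt {f : Space d → ℝ} (hf : Continuous f) :
    eLpNorm f 2 (torusMeasure d) =
      ENNReal.ofReal (Real.sqrt (∫ x, f x ^ 2 ∂(torusMeasure d))) := by
  have h := eLpNorm_eq_ofReal_integral (f := f) (q := 2) (by norm_num) (memLp_of_continuous hf _)
  rw [show ENNReal.ofReal 2 = 2 by simp] at h
  rw [h, Real.sqrt_eq_rpow]
  congr 2
  · refine integral_congr_ae (Filter.Eventually.of_forall fun x => ?_)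
    simp
  · norm_num

theorem norm_le_sum_abs (v : Space d) : ‖v‖ ≤ ∑ k, |v k| := by
  have : v = ∑ k, v k • (EuclideanSpace.single k 1 : Space d) := by
    ext j; simp [Finset.sum_apply, Pi.single_apply]
  calc ‖v‖ = ‖∑ k, v k • (EuclideanSpace.single k 1 : Space d)‖ := by rw [← this]
    _ ≤ ∑ k, ‖v k • (EuclideanSpace.single k 1 : Space d)‖ := norm_sum_le _ _
    _ = _ := by simp [norm_smul]

theorem eLpNorm_le_sum_coord {v : Space d → Space d}
    (hv : AEStronglyMeasurable v (torusMeasure d)) {q : ENNReal} (hq : 1 ≤ q) :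
    eLpNorm v q (torusMeasure d) ≤ ∑ k, eLpNorm (fun x => v x k) q (torusMeasure d) := by
  have hk (k : Fin d) : AEStronglyMeasurable (fun x => v x k) (torusMeasure d) :=
    (EuclideanSpace.proj k : Space d →L[ℝ] ℝ).continuous.comp_aestronglyMeasurable hv
  calc eLpNorm v q (torusMeasure d) ≤
        eLpNorm (∑ k, fun x => |v x k|) q (torusMeasure d) := by
        refine eLpNorm_mono fun x => ?_
        rw [Finset.sum_apply]
        exact (norm_le_sum_abs _).trans (le_abs_self _)
    _ ≤ ∑ k, eLpNorm (fun x => |v x k|) q (torusMeasure d) :=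
        eLpNorm_sum_le (fun k _ => (hk k).norm) hq
    _ = _ := Finset.sum_congr rfl fun k _ => eLpNorm_norm (fun x => v x k)

theorem prodProfile_mul (w v : ℝ → ℝ) (S : Finset (Fin d)) (x : Space d) :
    prodProfile (fun t => w t * v t) S x = prodProfile w S x * prodProfile v S x :=
  Finset.prod_mul_distrib

/-! ### Smallness of the concentrated scalar in L^2 and of its gradient -/

section Concentration

variable {N : ℕ} {s : ℝ}

/-- The normalised peak oscillating at frequency `N`, raised to the power `s`. -/
def oscProfile (N : ℕ) (s : ℝ) (n : ℕ) (t : ℝ) : ℝ := profile n (N * t) ^ s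

theorem oscProfile_pos (n : ℕ) (t : ℝ) : 0 < oscProfile N s n t :=
  Real.rpow_pos_of_pos (profile_pos _ _) _

theorem contDiff_profile_rpow (s : ℝ) (n : ℕ) : ContDiff ℝ (⊤ : ℕ∞) fun t => profile n t ^ s :=
  (contDiff_profile n).rpow_const_of_ne fun t => (profile_pos n t).ne'

theorem periodic_profile_rpow (s : ℝ) (n : ℕ) : Function.Periodic (fun t => profile n t ^ s) 1 :=
  fun t => by simp only [periodic_profile n t]

theorem contDiff_oscProfile (n : ℕ) : ContDiff ℝ (⊤ : ℕ∞) (oscProfile N s n) :=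
  (contDiff_profile_rpow s n).comp (by fun_prop)

theorem periodic_oscProfile (n : ℕ) : Function.Periodic (oscProfile N s n) 1 :=
  periodic_comp_nat_mul (periodic_profile_rpow s n) N

theorem integral_oscProfile (hN : 0 < N) (n : ℕ) :
    ∫ t, oscProfile N s n t ∂intervalMeasure = ∫ t, profile n t ^ s ∂intervalMeasure :=
  integral_comp_nat_mul (periodic_profile_rpow s n) (contDiff_profile_rpow s n).continuous hN

theorem oscProfile_rpow (n : ℕ) (r t : ℝ) : oscProfile N s n t ^ r = oscProfile N (s * r) n t :=
  (Real.rpow_mul (profile_pos _ _).le s r).symm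

theorem integral_oscProfile_one (hN : 0 < N) (n : ℕ) :
    ∫ t, oscProfile N 1 n t ∂intervalMeasure = 1 := by
  rw [integral_oscProfile hN]
  simpa using integral_profile n

theorem oscProfile_mul {s r : ℝ} (n : ℕ) (t : ℝ) :
    oscProfile N s n t * oscProfile N r n t = oscProfile N (s + r) n t :=
  (Real.rpow_add (profile_pos _ _) s r).symm

theorem integral_deriv_oscProfile_sq (hN : 0 < N) (n : ℕ) :
    ∫ t, deriv (oscProfile N s n) t ^ 2 ∂intervalMeasure =
      (N : ℝ) ^ 2 * ∫ t, deriv (fun r => profile n r ^ s) t ^ 2 ∂intervalMeasure := by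
  have hd (t : ℝ) : deriv (oscProfile N s n) t =
      N * deriv (fun r => profile n r ^ s) (N * t) := by
    have h0 : HasDerivAt (fun r : ℝ => (N : ℝ) * r) N t := by
      simpa using (hasDerivAt_id t).const_mul (N : ℝ)
    have h1 := ((contDiff_profile_rpow s n).differentiable (by simp) (N * t)).hasDerivAt.comp t h0
    exact h1.deriv.trans (mul_comm _ _)
  have hper : Function.Periodic (deriv fun r => profile n r ^ s) 1 := by
    intro t
    rw [← deriv_comp_add_const]
    congr 1
    funext r
    exact periodic_profile_rpow s n r
  simp only [hd, mul_pow]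
  rw [integral_const_mul]
  congr 1
  exact integral_comp_nat_mul (f := fun t => deriv (fun r => profile n r ^ s) t ^ 2)
    (fun t => by simp only [hper t])
    (((contDiff_profile_rpow s n).continuous_deriv (by simp)).pow 2) hN

/-- The square of the norm factors into d - 1 copies of the integral of the 2s-th power, and 2s < 1.
-/
theorem tendsto_eLpNorm_prodProfile (hN : 0 < N) (hs : 0 < s) (hs2 : 2 * s < 1) (hd : 2 ≤ d)
    (i : Fin d) :
    Filter.Tendsto (fun n => eLpNorm (prodProfile (oscProfile N s n) (Finset.univ.erase i)) 2
      (torusMeasure d)) Filter.atTop (nhds 0) := by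
  have e (n) : eLpNorm (prodProfile (oscProfile N s n) (Finset.univ.erase i)) 2
      (torusMeasure d) =
      ENNReal.ofReal (Real.sqrt ((∫ t, profile n t ^ (2 * s) ∂intervalMeasure) ^ (d - 1))) := by
    rw [eLpNorm_two_eq_ofReal_sqrt
      (isTest_prodProfile (contDiff_oscProfile n) (periodic_oscProfile n) _).continuous]
    simp only [pow_two, ← prodProfile_mul, oscProfile_mul]
    rw [integral_prodProfile, integral_oscProfile hN, ← two_mul]
    simp
  simp only [e]
  have h := ((tendsto_integral_profile_rpow (by positivity) hs2).pow (d - 1)).sqrt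
  rw [zero_pow (by omega), Real.sqrt_zero] at h
  simpa using ENNReal.tendsto_ofReal h

/-- The derivative falls on a single factor, so the squared norm is N² times the energy of
`tendsto_energy_profile`. The frequency N is fixed while n grows, hence its cost is harmless. -/
theorem tendsto_eLpNorm_pd_prodProfile (hN : 0 < N) (hs : 0 < s) (hd : 2 ≤ d)
    (hen : 1 < ((d : ℝ) - 1) * (1 / 2 - s)) (i j : Fin d) :
    Filter.Tendsto (fun n => eLpNorm (pd j (prodProfile (oscProfile N s n) (Finset.univ.erase i)))
      2 (torusMeasure d)) Filter.atTop (nhds 0) := by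
  by_cases hij : j = i
  · subst hij
    have e (n) : pd j (prodProfile (oscProfile N s n) (Finset.univ.erase j)) = 0 :=
      funext fun x => pd_prodProfile_of_notMem (contDiff_oscProfile n) (periodic_oscProfile n)
        (by simp) x
    simp [e]
  have hins : (Finset.univ.erase i : Finset (Fin d)) =
      insert j ((Finset.univ.erase i).erase j) := by
    rw [Finset.insert_erase (by simp [hij])]
  have e (n) : eLpNorm (pd j (prodProfile (oscProfile N s n) (Finset.univ.erase i))) 2
      (torusMeasure d) = ENNReal.ofReal (Real.sqrt ((N : ℝ) ^ 2 *
        ((∫ t, deriv (fun r => profile n r ^ s) t ^ 2 ∂intervalMeasure) *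
        (∫ t, profile n t ^ (2 * s) ∂intervalMeasure) ^ (d - 2)))) := by
    have hS : j ∉ ((Finset.univ.erase i).erase j : Finset (Fin d)) := by simp
    rw [eLpNorm_two_eq_ofReal_sqrt
      ((isTest_prodProfile (contDiff_oscProfile n) (periodic_oscProfile n) _).pd j).continuous]
    congr 2
    rw [hins, prodProfile_insert hS]
    simp only [pd_coord_mul_prodProfile (contDiff_oscProfile n) (periodic_oscProfile n)
      (contDiff_oscProfile n) (periodic_oscProfile n) j hS, if_true]
    have hprod := integral_prod_coord (d := d) fun k t => if k = j then
      deriv (oscProfile N s n) t ^ 2 else if k ∈ ((Finset.univ.erase i).erase j : Finset (Fin d))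
        then oscProfile N (2 * s) n t else 1
    have e1 (x : Space d) : (deriv (oscProfile N s n) (x j) *
        prodProfile (oscProfile N s n) ((Finset.univ.erase i).erase j) x) ^ 2 =
        ∏ k, if k = j then deriv (oscProfile N s n) (x k) ^ 2 else
          if k ∈ ((Finset.univ.erase i).erase j : Finset (Fin d))
          then oscProfile N (2 * s) n (x k) else 1 := by
      rw [← Finset.mul_prod_erase _ _ (Finset.mem_univ j), if_pos rfl, mul_pow]
      congr 1
      rw [pow_two, ← prodProfile_mul]
      simp only [oscProfile_mul, ← two_mul, prodProfile]
      rw [Finset.prod_congr (s₁ := Finset.univ.erase j) rfl (fun k hk => if_neg (by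
        simpa using hk)), Finset.prod_ite_mem]
      congr 1
      ext k; simp
    simp only [e1]
    rw [hprod, ← Finset.mul_prod_erase _ _ (Finset.mem_univ j)]
    simp only [if_true]
    rw [integral_deriv_oscProfile_sq hN, mul_assoc]
    congr 2
    have e2 (k : Fin d) (hk : k ∈ (Finset.univ.erase j : Finset (Fin d))) :
        ∫ t, (if k = j then deriv (oscProfile N s n) t ^ 2 else
          if k ∈ ((Finset.univ.erase i).erase j : Finset (Fin d))
          then oscProfile N (2 * s) n t else 1) ∂intervalMeasure =
        if k ∈ ((Finset.univ.erase i).erase j : Finset (Fin d)) then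
          ∫ t, profile n t ^ (2 * s) ∂intervalMeasure else 1 := by
      simp only [if_neg (by simpa using hk : ¬ k = j)]
      split_ifs
      · exact integral_oscProfile hN n
      · simp
    rw [Finset.prod_congr rfl e2, Finset.prod_ite_mem, Finset.prod_const]
    congr 1
    rw [show (Finset.univ.erase j ∩ (Finset.univ.erase i).erase j : Finset (Fin d)) =
      (Finset.univ.erase i).erase j by ext k; simp]
    rw [Finset.card_erase_of_mem (by simp [hij]), Finset.card_erase_of_mem (by simp)]
    simp; omega
  simp only [e]
  have h := ((tendsto_energy_profile hs hd hen).const_mul ((N : ℝ) ^ 2)).sqrt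
  rw [mul_zero, Real.sqrt_zero] at h
  simpa using ENNReal.tendsto_ofReal h

end Concentration

theorem IsTest.exists_bound {f : Space d → ℝ} (hf : IsTest f) :
    ∃ C : ℝ, 0 < C ∧ (∀ x ∈ cube d, |f x| ≤ C) ∧ ∀ k, ∀ x ∈ cube d, |TorusDrift.pd k f x| ≤ C := by
  obtain ⟨C, hC0, hC⟩ := exists_bound_cube hf.continuous
  choose K hK0 hK using fun k => exists_bound_cube (hf.pd k).continuous
  refine ⟨C + ∑ k, K k, add_pos_of_pos_of_nonneg hC0 (Finset.sum_nonneg fun k _ => (hK0 k).le),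
    fun x hx => (hC x hx).trans ?_, fun k x hx => (hK k x hx).trans ?_⟩
  · have := Finset.sum_nonneg fun k (_ : k ∈ Finset.univ) => (hK0 k).le
    linarith
  · have := Finset.single_le_sum (fun k _ => (hK0 k).le) (Finset.mem_univ k)
    linarith

theorem eLpNorm_le_const {F : Type*} [NormedAddCommGroup F] {f : Space d → F} {c : ℝ}
    (q : ENNReal) (h : ∀ x ∈ cube d, ‖f x‖ ≤ c) :
    eLpNorm f q (torusMeasure d) ≤ ENNReal.ofReal c := by
  have := eLpNorm_le_of_ae_bound (p := q) (ae_mem_cube.mono h)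
  simpa using this

/-- Used with aΦ in place of Φ, this controls the L^p and L^q norms of the perturbations by the L^1
size of the defect alone, which is all that survives the iteration. -/
theorem eLpNorm_le_of_integral_rpow_le {f Φ : Space d → ℝ} {c ρ q : ℝ}
    (hq : 1 ≤ q) (hc : 0 ≤ c) (hΦ : Continuous Φ) (hΦ0 : ∀ x, 0 ≤ Φ x)
    (h : ∀ x, |f x| ≤ c * Φ x ^ q⁻¹) (hρ : ∫ x, Φ x ∂(torusMeasure d) ≤ ρ) :
    eLpNorm f (ENNReal.ofReal q) (torusMeasure d) ≤ ENNReal.ofReal (c * ρ ^ q⁻¹) := by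
  have hq0 : 0 < q := by linarith
  have hΦc : Continuous fun x => Φ x ^ q⁻¹ :=
    hΦ.rpow_const fun _ => Or.inr (by positivity)
  refine (eLpNorm_le_const_mul (g := fun x => Φ x ^ q⁻¹) (c := c) _ fun x _ => ?_).trans ?_
  · rw [Real.norm_eq_abs, Real.norm_of_nonneg (Real.rpow_nonneg (hΦ0 x) _)]
    exact h x
  · rw [eLpNorm_eq_ofReal_integral hq (memLp_of_continuous hΦc _), ENNReal.ofReal_mul hc]
    gcongr
    · refine le_trans (le_of_eq ?_) hρ
      refine integral_congr_ae (Filter.Eventually.of_forall fun x => ?_)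
      simp only
      rw [Real.norm_of_nonneg (Real.rpow_nonneg (hΦ0 x) _), ← Real.rpow_mul (hΦ0 x),
        inv_mul_cancel₀ hq0.ne', Real.rpow_one]

/-- A divergence-free field `w` and a scalar `ϑ`, oscillating quickly and concentrated on thin
tubes in direction `i`, which interact through the low-frequency field `g e_i` only. -/
theorem exists_mikado (hd : 2 ≤ d) {p q : ℝ} (hpq : p.HolderConjugate q)
    (hen : 1 < ((d : ℝ) - 1) * (1 / 2 - q⁻¹)) {a g : Space d → ℝ} (ha : IsTest a)
    (ha0 : ∀ x, 0 < a x) (hg : IsTest g) (hga : ∀ x, |g x| ≤ a x) {ρ : ℝ}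
    (hρ : ∫ x, a x ∂(torusMeasure d) < ρ) {κ : ℝ} (hκ : 0 < κ) (i : Fin d) {ε : ℝ} (hε : 0 < ε) :
    ∃ (w Z : Space d → Space d) (ϑ : Space d → ℝ), Continuous w ∧ Continuous Z ∧ IsTest ϑ ∧
      IsDivFree w ∧
      IsDivFree (fun x => ϑ x • w x + Z x - g x • (EuclideanSpace.single i 1 : Space d)) ∧
      eLpNorm Z 1 (torusMeasure d) ≤ ENNReal.ofReal ε ∧
      eLpNorm w (ENNReal.ofReal p) (torusMeasure d) ≤ ENNReal.ofReal (κ * ρ ^ p⁻¹ + ε) ∧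
      eLpNorm w 1 (torusMeasure d) ≤ ENNReal.ofReal ε ∧
      eLpNorm ϑ (ENNReal.ofReal q) (torusMeasure d) ≤ ENNReal.ofReal (κ⁻¹ * ρ ^ q⁻¹) ∧
      eLpNorm ϑ 2 (torusMeasure d) ≤ ENNReal.ofReal ε ∧
      eLpNorm (gradient ϑ) 2 (torusMeasure d) ≤ ENNReal.ofReal ε := by
  have hp0 : 0 < p := hpq.pos
  have hq0 : 0 < q := hpq.symm.pos
  have hp1 : 1 < p := hpq.lt
  have hq1 : 1 < q := hpq.symm.lt
  have hpq1 : p⁻¹ + q⁻¹ = 1 := hpq.inv_add_inv_eq_one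
  have hpinv : p⁻¹ < 1 := inv_lt_one_of_one_lt₀ hp1
  have hd' : (2 : ℝ) ≤ d := by exact_mod_cast hd
  have hs2 : 2 * q⁻¹ < 1 := by
    by_contra h
    have : 1 / 2 - q⁻¹ ≤ 0 := by linarith
    nlinarith
  have hσ0 : 0 < q⁻¹ := by positivity
  set S : Finset (Fin d) := Finset.univ.erase i with hS
  have hiS : i ∉ S := by simp [hS]
  have hcard : S.card = d - 1 := by simp [hS]
  have hcard' : (S.card : ℝ) ≤ d := by rw [hcard]; exact_mod_cast Nat.sub_le d 1
  have hρ0 : 0 < ρ := lt_of_le_of_lt (integral_nonneg fun x => (ha0 x).le) hρ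
  -- the coefficients
  set A : Space d → ℝ := fun x => κ * a x ^ p⁻¹ with hAdef
  set B : Space d → ℝ := fun x => κ⁻¹ * (g x * a x ^ (-p⁻¹)) with hBdef
  have hrp (s : ℝ) : IsTest fun x => a x ^ s :=
    IsTest.comp (F := fun t => t ^ s) (s := Set.Ioi 0)
      (contDiffOn_id.rpow_const_of_ne fun x hx => (ne_of_gt hx)) isOpen_Ioi ha ha0
  have hA : IsTest A := (hrp _).const_mul κ
  have hB : IsTest B := (hg.mul (hrp _)).const_mul κ⁻¹
  -- A and B share g so that, after multiplication by the profiles, they are bounded by κ(aΦ)^(1/p)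
  -- and κ⁻¹(aΦ)^(1/q). Positivity of a makes its real powers smooth.
  have hAB (x) : A x * B x = g x := by
    have h1 : a x ^ p⁻¹ * a x ^ (-p⁻¹) = 1 := by
      rw [← Real.rpow_add (ha0 x), add_neg_cancel, Real.rpow_zero]
    calc A x * B x = (κ * κ⁻¹) * g x * (a x ^ p⁻¹ * a x ^ (-p⁻¹)) := by
          simp only [hAdef, hBdef]; ring
      _ = g x := by rw [h1, mul_inv_cancel₀ hκ.ne']; ring
  obtain ⟨Ka, hKa0, -, hKa⟩ := ha.exists_bound
  obtain ⟨Kg, hKg0, -, hKg⟩ := hg.exists_bound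
  obtain ⟨CA, hCA0, hCA, hKA⟩ := hA.exists_bound
  obtain ⟨CB, hCB0, hCB, hKB⟩ := hB.exists_bound
  -- the frequency
  obtain ⟨N, hN⟩ := exists_nat_gt (max 1 (max (d * Ka / (ρ - ∫ x, a x ∂(torusMeasure d)))
    (d * (2 * Kg) / (ε / 2))))
  have hN1 : (1 : ℝ) < N := (le_max_left _ _).trans_lt hN
  have hN0 : 0 < N := by exact_mod_cast (zero_lt_one.trans hN1)
  have hN0' : (0 : ℝ) < N := by exact_mod_cast hN0
  -- N has to beat derivatives of a and g only; nothing here depends on the concentration n, which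
  -- is chosen afterwards.
  have hNa : d * (1 / N * Ka) ≤ ρ - ∫ x, a x ∂(torusMeasure d) := by
    have h1 := ((le_max_left _ _).trans (le_max_right _ _)).trans_lt hN
    rw [div_lt_iff₀ (by linarith)] at h1
    rw [show d * (1 / N * Ka) = d * Ka / N by ring, div_le_iff₀ hN0']
    linarith
  have hNg : d * (2 * (1 / N) * Kg) ≤ ε / 2 := by
    have h1 := ((le_max_right _ _).trans (le_max_right _ _)).trans_lt hN
    rw [div_lt_iff₀ (by linarith)] at h1
    rw [show d * (2 * (1 / N) * Kg) = d * (2 * Kg) / N by ring, div_le_iff₀ hN0']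
    linarith
  -- the concentration parameter
  set m : ℕ → ℝ := fun n => ∫ t, profile n t ^ p⁻¹ ∂intervalMeasure with hm
  have hm0 (n) : 0 ≤ m n := integral_nonneg fun t => (Real.rpow_pos_of_pos (profile_pos n t) _).le
  have hmt : Filter.Tendsto m Filter.atTop (nhds 0) :=
    tendsto_integral_profile_rpow (by positivity) hpinv
  set M : ℝ := CA + d * (2 * CA) with hM
  set T : ℝ := κ⁻¹ * ρ ^ q⁻¹ with hT
  have hT0 : 0 ≤ T := by positivity
  have hev1 : ∀ᶠ n in Filter.atTop, m n ≤ 1 := hmt.eventually (ge_mem_nhds one_pos)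
  have hev2 : ∀ᶠ n in Filter.atTop, (CA + M) * m n ≤ ε := by
    have := hmt.const_mul (CA + M)
    rw [mul_zero] at this
    exact this.eventually (ge_mem_nhds hε)
  -- The corrector of w is multiplied by ϑ, whose L^q norm is bounded by T but not small; the
  -- corrector has to compensate for T.
  have hev3 : ∀ᶠ n in Filter.atTop, T * (M * m n) ≤ ε / 2 := by
    have := (hmt.const_mul M).const_mul T
    rw [mul_zero, mul_zero] at this
    exact this.eventually (ge_mem_nhds (half_pos hε))
  set Θ : ℕ → Space d → ℝ := fun n => prodProfile (oscProfile N q⁻¹ n) S with hΘ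
  have hΘt (n) : IsTest (Θ n) := isTest_prodProfile (contDiff_oscProfile n) (periodic_oscProfile n) S
  have hL := tendsto_eLpNorm_prodProfile (s := q⁻¹) hN0 hσ0 hs2 hd i
  have hLd := fun j => tendsto_eLpNorm_pd_prodProfile (s := q⁻¹) hN0 hσ0 hd hen i j
  have hεe : (0 : ENNReal) < ENNReal.ofReal ε := by simpa using hε
  have hev4 : ∀ᶠ n in Filter.atTop,
      ENNReal.ofReal CB * eLpNorm (Θ n) 2 (torusMeasure d) ≤ ENNReal.ofReal ε := by
    have := ENNReal.Tendsto.const_mul (a := ENNReal.ofReal CB) hL (Or.inr (by simp))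
    rw [mul_zero] at this
    exact this.eventually (ge_mem_nhds hεe)
  have hev5 : ∀ᶠ n in Filter.atTop,
      ∑ j : Fin d, (ENNReal.ofReal CB * eLpNorm (Θ n) 2 (torusMeasure d) +
        ENNReal.ofReal CB * eLpNorm (pd j (Θ n)) 2 (torusMeasure d)) ≤ ENNReal.ofReal ε := by
    have := tendsto_finsetSum (Finset.univ : Finset (Fin d)) fun j _ =>
      (ENNReal.Tendsto.const_mul (a := ENNReal.ofReal CB) hL (Or.inr (by simp))).add
        (ENNReal.Tendsto.const_mul (a := ENNReal.ofReal CB) (hLd j) (Or.inr (by simp)))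
    simp only [mul_zero, add_zero, Finset.sum_const_zero] at this
    exact this.eventually (ge_mem_nhds hεe)
  obtain ⟨n, h1, h2, h3, h4, h5⟩ := (hev1.and (hev2.and (hev3.and (hev4.and hev5)))).exists
  -- the three profiles
  set Ω : Space d → ℝ := prodProfile (oscProfile N p⁻¹ n) S with hΩ
  set Φ : Space d → ℝ := prodProfile (oscProfile N 1 n) S with hΦ
  have hΩt : IsTest Ω := isTest_prodProfile (contDiff_oscProfile n) (periodic_oscProfile n) S
  have hΦt : IsTest Φ := isTest_prodProfile (contDiff_oscProfile n) (periodic_oscProfile n) S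
  have hΦ0 (x) : 0 < Φ x := prodProfile_pos (oscProfile_pos n) S x
  have hΩΦ (x) : Ω x = Φ x ^ p⁻¹ := by
    rw [hΦ, prodProfile_rpow fun t => (oscProfile_pos n t).le]
    simp only [oscProfile_rpow, one_mul]; rfl
  have hΘΦ (x) : Θ n x = Φ x ^ q⁻¹ := by
    rw [hΦ, prodProfile_rpow fun t => (oscProfile_pos n t).le]
    simp only [oscProfile_rpow, one_mul]; rfl
  have hΩΘ (x) : Ω x * Θ n x = Φ x := by
    rw [hΩΦ, hΘΦ, ← Real.rpow_add (hΦ0 x), hpq1, Real.rpow_one]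
  have haΦ : ∫ x, a x * Φ x ∂(torusMeasure d) ≤ ρ := by
    obtain ⟨H, hH, hHp, hHd, hHb⟩ := exists_oscillating_primitive (contDiff_profile n)
      (periodic_profile n) (fun t => (profile_pos n t).le) hN0
    rw [integral_profile] at hHd hHb
    have := abs_integral_mul_prodProfile_sub_le (w := oscProfile N 1 n) (contDiff_oscProfile n)
      (periodic_oscProfile n) (fun t => (oscProfile_pos n t).le) hH hHp
      (fun t => by rw [hHd]; simp [oscProfile]) hHb (integral_oscProfile_one hN0 n) ha hKa S
    have h6 := (abs_le.1 this).2
    have h7 : (S.card : ℝ) * (1 / N * Ka) ≤ d * (1 / N * Ka) := by gcongr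
    linarith
  -- the correctors
  obtain ⟨E₁, hE₁c, hE₁, hE₁n⟩ : ∃ E : Space d → Space d, Continuous E ∧
      IsDivFree (fun x => (g x * Φ x) • (EuclideanSpace.single i 1 : Space d) - E x) ∧
      eLpNorm (fun x => E x - g x • (EuclideanSpace.single i 1 : Space d)) 1 (torusMeasure d) ≤
        ENNReal.ofReal (ε / 2) := by
    obtain ⟨H, hH, hHp, hHd, hHb⟩ := exists_oscillating_primitive (contDiff_profile n)
      (periodic_profile n) (fun t => (profile_pos n t).le) hN0
    rw [integral_profile] at hHd hHb
    obtain ⟨E, hEc, hE, hEn⟩ := exists_divFree_corrector (w := oscProfile N 1 n)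
      (contDiff_oscProfile n) (periodic_oscProfile n) (fun t => (oscProfile_pos n t).le) hH hHp
      zero_le_one le_rfl (fun t => by rw [hHd]; simp [oscProfile]) hHb (q := 1) le_rfl
      (by simpa using integral_oscProfile_one hN0 n) hg hKg S hiS
    refine ⟨E, hEc, hE, ?_⟩
    simp only [one_pow, one_mul, ENNReal.ofReal_one] at hEn
    refine hEn.trans (ENNReal.ofReal_le_ofReal (le_trans ?_ hNg))
    gcongr
  -- Unlike E₁, which is close to g e_i by high frequency, E₂ is small by concentration: both its
  -- average and its oscillating part are bounded by a multiple of the mean m n of the profile to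
  -- the power 1/p.
  obtain ⟨E₂, hE₂c, hE₂, hE₂n⟩ : ∃ E : Space d → Space d, Continuous E ∧
      IsDivFree (fun x => (A x * Ω x) • (EuclideanSpace.single i 1 : Space d) - E x) ∧
      eLpNorm E (ENNReal.ofReal p) (torusMeasure d) ≤ ENNReal.ofReal (M * m n) := by
    obtain ⟨H, hH, hHp, hHd, hHb⟩ := exists_oscillating_primitive (contDiff_profile_rpow p⁻¹ n)
      (periodic_profile_rpow p⁻¹ n) (fun t => (Real.rpow_pos_of_pos (profile_pos n t) _).le) hN0
    obtain ⟨E, hEc, hE, hEn⟩ := exists_divFree_corrector (w := oscProfile N p⁻¹ n)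
      (contDiff_oscProfile n) (periodic_oscProfile n) (fun t => (oscProfile_pos n t).le) hH hHp
      (hm0 n) h1 (fun t => by rw [hHd]; rfl) hHb (q := p) hp1.le
      (by simpa only [oscProfile_rpow, inv_mul_cancel₀ hp0.ne'] using
        integral_oscProfile_one hN0 n) hA hKA S hiS
    refine ⟨E, hEc, hE, ?_⟩
    have hc : Continuous fun x => (m n ^ S.card * A x) • (EuclideanSpace.single i 1 : Space d) :=
      (continuous_const.mul hA.continuous).smul continuous_const
    have e : E = (fun x => E x - (m n ^ S.card * A x) • (EuclideanSpace.single i 1 : Space d)) +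
        fun x => (m n ^ S.card * A x) • (EuclideanSpace.single i 1 : Space d) := by
      funext x; exact (sub_add_cancel (E x) _).symm
    rw [e]
    refine (eLpNorm_add_le (hEc.sub hc).aestronglyMeasurable hc.aestronglyMeasurable
      (by simpa using hp1.le)).trans ?_
    have hc2 := eLpNorm_le_const (f := fun x => (m n ^ S.card * A x) •
      (EuclideanSpace.single i 1 : Space d)) (c := CA * m n) (ENNReal.ofReal p) (fun x hx => by
        rw [norm_smul, PiLp.norm_single, norm_one, mul_one, norm_mul, norm_pow,
          Real.norm_of_nonneg (hm0 n), Real.norm_eq_abs, mul_comm]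
        have : m n ^ S.card ≤ m n := pow_le_of_le_one (hm0 n) h1 (by omega)
        exact mul_le_mul (hCA x hx) this (pow_nonneg (hm0 n) _) hCA0.le)
    refine (add_le_add hEn hc2).trans ?_
    have hmn := hm0 n
    rw [← ENNReal.ofReal_add (mul_nonneg (Nat.cast_nonneg _) (by positivity)) (by positivity)]
    refine ENNReal.ofReal_le_ofReal ?_
    have h6 : m n / N ≤ m n := div_le_self hmn hN1.le
    calc (S.card : ℝ) * (2 * (m n / N) * CA) + CA * m n ≤ d * (2 * m n * CA) + CA * m n := by
          gcongr
      _ = M * m n := by rw [hM]; ring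
  set w : Space d → Space d := fun x =>
    (A x * Ω x) • (EuclideanSpace.single i 1 : Space d) - E₂ x with hw
  set ϑ : Space d → ℝ := fun x => B x * Θ n x with hϑ
  have hϑt : IsTest ϑ := hB.mul (hΘt n)
  have hmain : Continuous fun x => (A x * Ω x) • (EuclideanSpace.single i 1 : Space d) :=
    (hA.continuous.mul hΩt.continuous).smul continuous_const
  have hϑq : eLpNorm ϑ (ENNReal.ofReal q) (torusMeasure d) ≤ ENNReal.ofReal T := by
    refine eLpNorm_le_of_integral_rpow_le hq1.le (by positivity)
      (ha.mul hΦt).continuous (fun x => (mul_pos (ha0 x) (hΦ0 x)).le) (fun x => ?_) haΦ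
    have hax := ha0 x
    have hΦx := hΦ0 x
    simp only [hϑ, hBdef]
    rw [abs_mul, abs_mul, abs_mul, abs_of_pos (inv_pos.2 hκ), hΘΦ,
      abs_of_pos (Real.rpow_pos_of_pos hΦx _), abs_of_pos (Real.rpow_pos_of_pos hax _),
      Real.mul_rpow hax.le hΦx.le]
    have : |g x| * a x ^ (-p⁻¹) ≤ a x ^ q⁻¹ := by
      calc |g x| * a x ^ (-p⁻¹) ≤ a x * a x ^ (-p⁻¹) := by gcongr; exact hga x
        _ = a x ^ (1 + -p⁻¹) := by rw [Real.rpow_add hax, Real.rpow_one]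
        _ = a x ^ q⁻¹ := by congr 1; linarith
    calc _ = κ⁻¹ * (|g x| * a x ^ (-p⁻¹)) * Φ x ^ q⁻¹ := by ring
      _ ≤ κ⁻¹ * (a x ^ q⁻¹) * Φ x ^ q⁻¹ := by gcongr
      _ = _ := by ring
  have hE₂1 : eLpNorm E₂ 1 (torusMeasure d) ≤ ENNReal.ofReal (M * m n) :=
    (eLpNorm_le_eLpNorm_of_exponent_le (by simpa using hp1.le) hE₂c.aestronglyMeasurable).trans
      hE₂n
  have hM0 : 0 ≤ M := by positivity
  have hϑΘ : ∀ x ∈ cube d, ‖ϑ x‖ ≤ CB * ‖Θ n x‖ := fun x hx => by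
    rw [hϑ, norm_mul]; gcongr; exact hCB x hx
  -- Since AB = g and ΩΘ = Φ, ϑw = gΦ e_i - ϑE₂. With this Z, the field ϑw + Z - g e_i is exactly gΦ
  -- e_i - E₁, which is divergence-free.
  refine ⟨w, fun x => ϑ x • E₂ x - (E₁ x - g x • (EuclideanSpace.single i 1 : Space d)), ϑ,
    hmain.sub hE₂c, ?_, hϑt, hE₂, ?_, ?_, ?_, ?_, hϑq, ?_, ?_⟩
  · exact (hϑt.continuous.smul hE₂c).sub (hE₁c.sub (hg.continuous.smul continuous_const))
  · convert hE₁ using 1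
    funext x
    simp only [hw, hϑ]
    rw [← hAB, ← hΩΘ]
    module
  · have hc1 : Continuous fun x => ϑ x • E₂ x := hϑt.continuous.smul hE₂c
    have hc2 : Continuous fun x => E₁ x - g x • (EuclideanSpace.single i 1 : Space d) :=
      hE₁c.sub (hg.continuous.smul continuous_const)
    refine (eLpNorm_sub_le hc1.aestronglyMeasurable hc2.aestronglyMeasurable le_rfl).trans ?_
    have : ENNReal.HolderTriple (ENNReal.ofReal q) (ENNReal.ofReal p) 1 :=
      ⟨by
        rw [inv_one, ← ENNReal.ofReal_inv_of_pos hq0, ← ENNReal.ofReal_inv_of_pos hp0,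
          ← ENNReal.ofReal_add (by positivity) (by positivity), add_comm, hpq1,
          ENNReal.ofReal_one]⟩
    have h6 : eLpNorm (fun x => ϑ x • E₂ x) 1 (torusMeasure d) ≤ ENNReal.ofReal (ε / 2) := by
      refine (eLpNorm_smul_le_mul_eLpNorm (p := ENNReal.ofReal q) (q := ENNReal.ofReal p)
        hE₂c.aestronglyMeasurable hϑt.continuous.aestronglyMeasurable).trans ?_
      refine (mul_le_mul' hϑq hE₂n).trans ?_
      rw [← ENNReal.ofReal_mul hT0]
      exact ENNReal.ofReal_le_ofReal h3
    calc _ ≤ ENNReal.ofReal (ε / 2) + ENNReal.ofReal (ε / 2) := add_le_add h6 hE₁n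
      _ = _ := by rw [← ENNReal.ofReal_add (by positivity) (by positivity), add_halves]
  · refine (eLpNorm_sub_le hmain.aestronglyMeasurable hE₂c.aestronglyMeasurable
      (by simpa using hp1.le)).trans ?_
    rw [ENNReal.ofReal_add (by positivity) hε.le]
    refine add_le_add ?_ (hE₂n.trans (ENNReal.ofReal_le_ofReal ?_))
    · have h6 := eLpNorm_le_of_integral_rpow_le (f := fun x => A x * Ω x) (Φ := fun x => a x * Φ x)
        hp1.le hκ.le (ha.mul hΦt).continuous
        (fun x => (mul_pos (ha0 x) (hΦ0 x)).le) (fun x => by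
          have hax := ha0 x
          have hΦx := hΦ0 x
          simp only [hAdef]
          rw [hΩΦ, Real.mul_rpow hax.le hΦx.le, abs_of_nonneg (by positivity)]
          exact le_of_eq (by ring)) haΦ
      refine le_trans (eLpNorm_mono fun x => ?_) h6
      rw [norm_smul, PiLp.norm_single, norm_one, mul_one]
    · have := hm0 n
      nlinarith
  · refine (eLpNorm_sub_le hmain.aestronglyMeasurable hE₂c.aestronglyMeasurable le_rfl).trans ?_
    have h6 : eLpNorm (fun x => (A x * Ω x) • (EuclideanSpace.single i 1 : Space d)) 1
        (torusMeasure d) ≤ ENNReal.ofReal (CA * m n) := by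
      refine (eLpNorm_le_const_mul (g := Ω) (c := CA) 1 fun x hx => by
        rw [norm_smul, PiLp.norm_single, norm_one, mul_one, norm_mul]
        gcongr
        exact hCA x hx).trans ?_
      have h7 := eLpNorm_eq_ofReal_integral (f := Ω) (q := 1) le_rfl
        (memLp_of_continuous hΩt.continuous _)
      simp only [ENNReal.ofReal_one, Real.rpow_one, inv_one] at h7
      have h8 : ∫ x, ‖Ω x‖ ∂(torusMeasure d) = m n ^ S.card := by
        simp only [Real.norm_of_nonneg (prodProfile_nonneg (fun t => (oscProfile_pos n t).le) S _),
          hΩ]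
        rw [integral_prodProfile, integral_oscProfile hN0]
      rw [h7, h8, ← ENNReal.ofReal_mul hCA0.le]
      refine ENNReal.ofReal_le_ofReal ?_
      gcongr
      exact pow_le_of_le_one (hm0 n) h1 (by omega)
    refine (add_le_add h6 hE₂1).trans ?_
    rw [← ENNReal.ofReal_add (mul_nonneg hCA0.le (hm0 n)) (mul_nonneg hM0 (hm0 n)), ← add_mul]
    exact ENNReal.ofReal_le_ofReal h2
  · exact (eLpNorm_le_const_mul 2 hϑΘ).trans h4
  · refine (eLpNorm_le_sum_coord hϑt.continuous_gradient.aestronglyMeasurable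
      (by norm_num)).trans (le_trans (Finset.sum_le_sum fun j _ => ?_) h5)
    have e : (fun x => gradient ϑ x j) =
        (fun x => pd j B x * Θ n x) + fun x => B x * pd j (Θ n) x := by
      funext x
      simp only [gradient_apply, hϑ, Pi.add_apply]
      exact pd_mul hB (hΘt n) j x
    rw [e]
    refine (eLpNorm_add_le ((hB.pd j).mul (hΘt n)).continuous.aestronglyMeasurable
      (hB.mul ((hΘt n).pd j)).continuous.aestronglyMeasurable (by norm_num)).trans ?_
    gcongr
    · refine eLpNorm_le_const_mul 2 fun x hx => ?_
      rw [norm_mul]; gcongr; exact hKB j x hx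
    · refine eLpNorm_le_const_mul 2 fun x hx => ?_
      rw [norm_mul]; gcongr; exact hCB x hx

/-! ### Approximate solutions -/

/-- An approximate solution: a divergence-free drift `b ∈ L^p`, a smooth `u` and an integrable
defect `R` with `div (∇u + b u) = div R`. -/
structure Subsolution (p : ℝ) (b : Space d → Space d) (u : Space d → ℝ) (R : Space d → Space d) :
    Prop where
  memLp : MemLp b (ENNReal.ofReal p) (torusMeasure d)
  divFree : IsDivFree b
  test : IsTest u
  integrable : Integrable R (torusMeasure d)
  eqn : IsDivFree fun x => gradient u x + u x • b x - R x

theorem eLpNorm_one_eq_ofReal_integral {F : Type*} [NormedAddCommGroup F] {f : Space d → F}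
    (hf : Integrable f (torusMeasure d)) :
    eLpNorm f 1 (torusMeasure d) = ENNReal.ofReal (∫ x, ‖f x‖ ∂(torusMeasure d)) := by
  rw [eLpNorm_one_eq_lintegral_enorm]
  exact (ofReal_integral_norm_eq_lintegral_enorm hf).symm

theorem integral_norm_le_of_eLpNorm_le {F : Type*} [NormedAddCommGroup F] {f : Space d → F}
    (hf : Integrable f (torusMeasure d)) {c : ℝ} (hc : 0 ≤ c)
    (h : eLpNorm f 1 (torusMeasure d) ≤ ENNReal.ofReal c) :
    ∫ x, ‖f x‖ ∂(torusMeasure d) ≤ c := by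
  rw [eLpNorm_one_eq_ofReal_integral hf] at h
  exact (ENNReal.ofReal_le_ofReal_iff hc).1 h

theorem Integrable.coord {R : Space d → Space d} (h : Integrable R (torusMeasure d)) (i : Fin d) :
    Integrable (fun x => R x i) (torusMeasure d) :=
  (EuclideanSpace.proj i : Space d →L[ℝ] ℝ).integrable_comp h

theorem gradient_sub_of_isTest {f g : Space d → ℝ} (hf : IsTest f) (hg : IsTest g) (x : Space d) :
    gradient (fun y => f y - g y) x = gradient f x - gradient g x := by
  ext k
  simp only [gradient_apply, PiLp.sub_apply, pd_sub hf hg]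

/-- A positive test function that dominates the integrable function `f` and one of its smooth
approximations `g`, without increasing the mass much. -/
theorem exists_smooth_majorant {f : Space d → ℝ} (hf : Integrable f (torusMeasure d)) {ρ δ : ℝ}
    (hρ : ∫ x, |f x| ∂(torusMeasure d) < ρ) (hδ : 0 < δ) :
    ∃ a g : Space d → ℝ, IsTest a ∧ IsTest g ∧ (∀ x, 0 < a x) ∧ (∀ x, |g x| ≤ a x) ∧
      ∫ x, a x ∂(torusMeasure d) < ρ ∧
      eLpNorm (f - g) 1 (torusMeasure d) ≤ ENNReal.ofReal δ := by
  -- Of the slack τ, one third pays for the regularisation √((τ/3)² + g²) ≤ τ/3 + |g| and one third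
  -- for replacing f by g; the last third keeps the inequality strict.
  set τ := ρ - ∫ x, |f x| ∂(torusMeasure d) with hτ
  have hτ0 : 0 < τ := by linarith
  obtain ⟨g, hg, hfg⟩ := exists_isTest_eLpNorm_sub_le hf (lt_min (by positivity : 0 < τ / 3) hδ)
  have hfg' := integral_norm_le_of_eLpNorm_le (hf.sub hg.integrable) (by positivity) hfg
  have hin (x : Space d) : 0 < (τ / 3) ^ 2 + g x * g x :=
    add_pos_of_pos_of_nonneg (by positivity) (mul_self_nonneg _)
  have ha : IsTest fun x => Real.sqrt ((τ / 3) ^ 2 + g x * g x) :=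
    IsTest.comp (s := Set.Ioi 0)
      (fun x hx => (Real.contDiffAt_sqrt (ne_of_gt hx)).contDiffWithinAt) isOpen_Ioi
      ((IsTest.const _).add (hg.mul hg)) hin
  refine ⟨_, g, ha, hg, fun x => Real.sqrt_pos.2 (hin x), fun x => ?_, ?_,
    hfg.trans (ENNReal.ofReal_le_ofReal (min_le_right _ _))⟩
  · rw [← Real.sqrt_sq_eq_abs]
    apply Real.sqrt_le_sqrt
    nlinarith [sq_nonneg (τ / 3)]
  · have hi1 := (hf.sub hg.integrable).norm
    have hi2 : Integrable (fun x => |f x|) (torusMeasure d) := hf.norm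
    have hi12 : Integrable (fun x => ‖(f - g) x‖ + |f x|) (torusMeasure d) := hi1.add hi2
    calc _ ≤ ∫ x, (τ / 3 + (‖(f - g) x‖ + |f x|)) ∂(torusMeasure d) := by
          refine integral_mono ha.integrable ((integrable_const _).add (hi1.add hi2)) fun x => ?_
          simp only [Pi.sub_apply, Real.norm_eq_abs]
          refine (Real.sqrt_le_sqrt (y := (τ / 3 + |g x|) ^ 2) ?_).trans ?_
          · have := abs_mul_abs_self (g x)
            nlinarith [abs_nonneg (g x)]
          · rw [Real.sqrt_sq (by positivity)]
            have h1 := abs_sub_abs_le_abs_sub (g x) (f x)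
            rw [abs_sub_comm] at h1
            linarith
      _ = τ / 3 + (∫ x, ‖(f - g) x‖ ∂(torusMeasure d) + ∫ x, |f x| ∂(torusMeasure d)) := by
          rw [integral_add (integrable_const _) hi12, integral_add hi1 hi2]
          simp
      _ < ρ := by
          have := hfg'.trans (min_le_left _ _)
          linarith

theorem holderTriple_ofReal {p q : ℝ} (hpq : p.HolderConjugate q) :
    ENNReal.HolderTriple (ENNReal.ofReal q) (ENNReal.ofReal p) 1 :=
  ⟨by
    rw [inv_one, ← ENNReal.ofReal_inv_of_pos hpq.symm.pos, ← ENNReal.ofReal_inv_of_pos hpq.pos,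
      ← ENNReal.ofReal_add hpq.symm.inv_nonneg hpq.inv_nonneg, hpq.symm.inv_add_inv_eq_one,
      ENNReal.ofReal_one]⟩

theorem eLpNorm_smul_le_of_holder {p q : ℝ} (hpq : p.HolderConjugate q) {u : Space d → ℝ}
    {b : Space d → Space d} (hu : AEStronglyMeasurable u (torusMeasure d))
    (hb : AEStronglyMeasurable b (torusMeasure d)) :
    eLpNorm (fun x => u x • b x) 1 (torusMeasure d) ≤
      eLpNorm u (ENNReal.ofReal q) (torusMeasure d) *
        eLpNorm b (ENNReal.ofReal p) (torusMeasure d) := by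
  have := holderTriple_ofReal hpq
  change eLpNorm (u • b) 1 (torusMeasure d) ≤ _
  exact eLpNorm_smul_le_mul_eLpNorm hb hu

theorem integrable_of_memLp {F : Type*} [NormedAddCommGroup F] {f : Space d → F} {p : ENNReal}
    (hp : 1 ≤ p) (h : MemLp f p (torusMeasure d)) : Integrable f (torusMeasure d) :=
  memLp_one_iff_integrable.1 (h.mono_exponent hp)

/-- One perturbation removes the `i`-th component of the defect. -/
theorem Subsolution.exists_step (hd : 2 ≤ d) {p q : ℝ} (hpq : p.HolderConjugate q)
    (hen : 1 < ((d : ℝ) - 1) * (1 / 2 - q⁻¹)) {b R : Space d → Space d} {u : Space d → ℝ}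
    (h : Subsolution p b u R) (i : Fin d) {ρ η δ : ℝ}
    (hρ : ∫ x, |R x i| ∂(torusMeasure d) < ρ) (hη : 0 < η) (hδ : 0 < δ) :
    ∃ (b' R' : Space d → Space d) (u' : Space d → ℝ), Subsolution p b' u' R' ∧
      eLpNorm (b' - b) (ENNReal.ofReal p) (torusMeasure d) ≤ ENNReal.ofReal η ∧
      eLpNorm (u' - u) (ENNReal.ofReal q) (torusMeasure d) ≤ ENNReal.ofReal (2 * ρ / η) ∧
      eLpNorm (u' - u) 2 (torusMeasure d) ≤ ENNReal.ofReal δ ∧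
      eLpNorm (gradient u' - gradient u) 2 (torusMeasure d) ≤ ENNReal.ofReal δ ∧
      ∀ j, ∫ x, |R' x j - if j = i then 0 else R x j| ∂(torusMeasure d) ≤ δ := by
  have hp1 : (1 : ENNReal) ≤ ENNReal.ofReal p := by simpa using hpq.lt.le
  obtain ⟨a, g, ha, hg, ha0, hga, haρ, hfg⟩ :=
    exists_smooth_majorant (Integrable.coord h.integrable i) hρ (by positivity : 0 < δ / 5)
  have hρ0 : 0 < ρ := (integral_nonneg fun x => abs_nonneg _).trans_lt hρ
  -- The main part of w gets L^p norm at most η/2, the other half being left for the corrector; then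
  -- ϑ has L^q norm at most 2ρ/η.
  set κ := η / (2 * ρ ^ p⁻¹) with hκ
  have hκ0 : 0 < κ := by positivity
  have hκ1 : κ * ρ ^ p⁻¹ = η / 2 := by rw [hκ]; field_simp
  have hκ2 : κ⁻¹ * ρ ^ q⁻¹ = 2 * ρ / η := by
    have : ρ ^ p⁻¹ * ρ ^ q⁻¹ = ρ := by
      rw [← Real.rpow_add hρ0, hpq.inv_add_inv_eq_one, Real.rpow_one]
    rw [hκ, inv_div, div_mul_eq_mul_div, mul_assoc, this]
  set T := 2 * ρ / η with hT
  have hT0 : 0 < T := by positivity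
  have hτ0 : 0 < δ / (10 * T) := by positivity
  -- The term ϑb is the delicate one: b is only in L^p and ϑ is not small in L^q. The unbounded part
  -- b - c is made small in L^p against the bound T, which is known before ϑ is constructed; the
  -- bounded part c meets ϑ in L^1, where ϑ is small.
  obtain ⟨c, hbc, hcp⟩ := h.memLp.exists_boundedContinuous_eLpNorm_sub_le (by simp)
    (ε := ENNReal.ofReal (δ / (10 * T))) (by simpa using hτ0)
  obtain ⟨U, hU0, hU⟩ := exists_bound_cube h.test.continuous
  set ε := min (min (δ / 5) (η / 2)) (min (δ / (5 * U)) (δ / (10 * (‖c‖ + 1)))) with hε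
  have hε0 : 0 < ε := by
    have : 0 < ‖c‖ + 1 := by positivity
    rw [hε]; positivity
  have hε1 : ε ≤ δ / 5 := (min_le_left _ _).trans (min_le_left _ _)
  have hε2 : ε ≤ η / 2 := (min_le_left _ _).trans (min_le_right _ _)
  have hε3 : U * ε ≤ δ / 5 := by
    have : ε ≤ δ / (5 * U) := (min_le_right _ _).trans (min_le_left _ _)
    rw [le_div_iff₀ (by positivity)] at this
    linarith
  have hε4 : ‖c‖ * ε ≤ δ / 10 := by
    have : ε ≤ δ / (10 * (‖c‖ + 1)) := (min_le_right _ _).trans (min_le_right _ _)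
    rw [le_div_iff₀ (by positivity)] at this
    linarith
  obtain ⟨w, Z, ϑ, hw, hZ, hϑ, hwd, hwZ, hZ1, hwp, hw1, hϑq, hϑ2, hϑg⟩ :=
    exists_mikado hd hpq hen ha ha0 hg hga haρ hκ0 i hε0
  rw [hκ1] at hwp
  rw [hκ2] at hϑq
  have hbi : Integrable b (torusMeasure d) := integrable_of_memLp hp1 h.memLp
  have hϑb : Integrable (fun x => ϑ x • b x) (torusMeasure d) := by
    obtain ⟨C, -, hC⟩ := exists_bound_cube hϑ.continuous
    refine Integrable.mono' (hbi.norm.const_mul C)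
      (hϑ.continuous.aestronglyMeasurable.smul hbi.aestronglyMeasurable) ?_
    filter_upwards [ae_mem_cube] with x hx
    rw [norm_smul]; gcongr; exact hC x hx
  have hub : Integrable (fun x => u x • b x) (torusMeasure d) := by
    refine Integrable.mono' (hbi.norm.const_mul U)
      (h.test.continuous.aestronglyMeasurable.smul hbi.aestronglyMeasurable) ?_
    filter_upwards [ae_mem_cube] with x hx
    rw [norm_smul]; gcongr; exact hU x hx
  have hgr := hϑ.continuous_gradient
  have hgi := integrable_of_continuous hgr
  have huw : Continuous fun x => u x • w x := h.test.continuous.smul hw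
  have huwi := integrable_of_continuous huw
  have hZi := integrable_of_continuous hZ
  have hge : Continuous fun x => g x • (EuclideanSpace.single i 1 : Space d) :=
    hg.continuous.smul continuous_const
  -- These are the new terms of ∇(u - ϑ) + (u - ϑ)(b + w), with -ϑw replaced by Z - g e_i, from
  -- which it differs by a divergence-free field. Each of the four terms is allotted δ/5, and the
  -- last fifth goes to R_i - g.
  set D : Space d → Space d := fun x => u x • w x - gradient ϑ x - ϑ x • b x + Z x with hD
  have hDi : Integrable D (torusMeasure d) := ((huwi.sub hgi).sub hϑb).add hZi
  have hR' : Integrable (fun x => R x - g x • (EuclideanSpace.single i 1 : Space d) + D x)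
      (torusMeasure d) := (h.integrable.sub (integrable_of_continuous hge)).add hDi
  have hD1 : eLpNorm D 1 (torusMeasure d) ≤ ENNReal.ofReal (4 * (δ / 5)) := by
    have e1 : eLpNorm (fun x => u x • w x) 1 (torusMeasure d) ≤ ENNReal.ofReal (δ / 5) := by
      refine (eLpNorm_le_const_mul (g := w) (c := U) 1 fun x hx => by
        rw [norm_smul]; gcongr; exact hU x hx).trans ?_
      refine (mul_le_mul' le_rfl hw1).trans ?_
      rw [← ENNReal.ofReal_mul hU0.le]
      exact ENNReal.ofReal_le_ofReal hε3
    have e2 : eLpNorm (gradient ϑ) 1 (torusMeasure d) ≤ ENNReal.ofReal (δ / 5) :=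
      (eLpNorm_le_eLpNorm_of_exponent_le (by norm_num) hgr.aestronglyMeasurable).trans
        (hϑg.trans (ENNReal.ofReal_le_ofReal hε1))
    have e3 : eLpNorm (fun x => ϑ x • b x) 1 (torusMeasure d) ≤ ENNReal.ofReal (δ / 5) := by
      have hcm : AEStronglyMeasurable c (torusMeasure d) := c.continuous.aestronglyMeasurable
      have hϑm := hϑ.continuous.aestronglyMeasurable (μ := torusMeasure d)
      have s1 : (fun x => ϑ x • b x) = (fun x => ϑ x • (b - c) x) + fun x => ϑ x • c x := by
        funext x; simp [smul_sub]
      have s2 := eLpNorm_smul_le_of_holder hpq hϑm (h.memLp.aestronglyMeasurable.sub hcm)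
      have s3 : eLpNorm (fun x => ϑ x • c x) 1 (torusMeasure d) ≤
          ENNReal.ofReal ‖c‖ * eLpNorm ϑ 1 (torusMeasure d) :=
        eLpNorm_le_const_mul 1 fun x _ => by
          rw [norm_smul, mul_comm]; gcongr; exact c.norm_coe_le_norm x
      have s4 : eLpNorm ϑ 1 (torusMeasure d) ≤ ENNReal.ofReal ε :=
        (eLpNorm_le_eLpNorm_of_exponent_le (by norm_num) hϑm).trans hϑ2
      rw [s1]
      refine (eLpNorm_add_le (hϑm.smul (h.memLp.aestronglyMeasurable.sub hcm)) (hϑm.smul hcm)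
        le_rfl).trans ?_
      calc _ ≤ ENNReal.ofReal T * ENNReal.ofReal (δ / (10 * T)) +
            ENNReal.ofReal ‖c‖ * ENNReal.ofReal ε := by
            refine add_le_add (s2.trans ?_) (s3.trans ?_)
            · gcongr
            · gcongr
        _ = ENNReal.ofReal (T * (δ / (10 * T)) + ‖c‖ * ε) := by
            rw [← ENNReal.ofReal_mul hT0.le, ← ENNReal.ofReal_mul (norm_nonneg _),
              ← ENNReal.ofReal_add (by positivity) (by positivity)]
        _ ≤ _ := by
            refine ENNReal.ofReal_le_ofReal ?_
            have : T * (δ / (10 * T)) = δ / 10 := by field_simp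
            linarith
    have e4 : eLpNorm Z 1 (torusMeasure d) ≤ ENNReal.ofReal (δ / 5) :=
      hZ1.trans (ENNReal.ofReal_le_ofReal hε1)
    have m1 := huw.aestronglyMeasurable (μ := torusMeasure d)
    have m2 := hgr.aestronglyMeasurable (μ := torusMeasure d)
    have m3 := hϑb.aestronglyMeasurable
    have t := (eLpNorm_add_le ((m1.sub m2).sub m3) hZi.aestronglyMeasurable le_rfl).trans
      (add_le_add ((eLpNorm_sub_le (m1.sub m2) m3 le_rfl).trans
        (add_le_add ((eLpNorm_sub_le m1 m2 le_rfl).trans (add_le_add e1 e2)) e3)) e4)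
    refine t.trans (le_of_eq ?_)
    rw [← ENNReal.ofReal_add (by positivity) (by positivity),
      ← ENNReal.ofReal_add (by positivity) (by positivity),
      ← ENNReal.ofReal_add (by positivity) (by positivity)]
    ring_nf
  refine ⟨fun x => b x + w x, fun x => R x - g x • (EuclideanSpace.single i 1 : Space d) + D x,
    fun x => u x - ϑ x, ⟨?_, ?_, h.test.sub hϑ, hR', ?_⟩, ?_, ?_, ?_, ?_, fun j => ?_⟩
  · exact h.memLp.add (memLp_of_continuous hw _)
  · exact h.divFree.add hwd hbi (integrable_of_continuous hw)
  · have := h.eqn.add (hwZ.const_smul (-1))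
      (((integrable_of_continuous h.test.continuous_gradient).add hub).sub h.integrable)
      (integrable_of_continuous ((((hϑ.continuous.smul hw).add hZ).sub hge).const_smul (-1 : ℝ)))
    convert this using 1
    funext x
    rw [gradient_sub_of_isTest h.test hϑ]
    simp only [hD]
    module
  · rw [show (fun x => b x + w x) - b = w by funext x; simp]
    exact hwp.trans (ENNReal.ofReal_le_ofReal (by linarith))
  · rw [show (fun x => u x - ϑ x) - u = -ϑ by funext x; simp, eLpNorm_neg]
    exact hϑq
  · rw [show (fun x => u x - ϑ x) - u = -ϑ by funext x; simp, eLpNorm_neg]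
    exact hϑ2.trans (ENNReal.ofReal_le_ofReal (by linarith))
  · rw [show gradient (fun x => u x - ϑ x) - gradient u = -gradient ϑ by
      funext x; simp [gradient_sub_of_isTest h.test hϑ], eLpNorm_neg]
    exact hϑg.trans (ENNReal.ofReal_le_ofReal (by linarith))
  · have hfi := (Integrable.coord h.integrable i).sub hg.integrable
    have b1 := integral_norm_le_of_eLpNorm_le hfi (by positivity) hfg
    have b2 := integral_norm_le_of_eLpNorm_le hDi (by positivity) hD1
    calc _ ≤ ∫ x, (‖((fun x => R x i) - g) x‖ + ‖D x‖) ∂(torusMeasure d) := by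
          refine integral_mono ?_ (hfi.norm.add hDi.norm) fun x => ?_
          · refine Integrable.abs ((Integrable.coord hR' j).sub ?_)
            split_ifs
            · exact integrable_zero _ _ _
            · exact Integrable.coord h.integrable j
          · have hDj : |D x j| ≤ ‖D x‖ := PiLp.norm_apply_le (D x) j
            by_cases hj : j = i
            · subst hj
              simp only [if_true, sub_zero, PiLp.add_apply, PiLp.sub_apply, PiLp.smul_apply,
                Pi.sub_apply, Real.norm_eq_abs]
              simp only [PiLp.single_apply, if_true, smul_eq_mul, mul_one]
              exact (abs_add_le _ _).trans (add_le_add le_rfl hDj)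
            · simp only [if_neg hj, PiLp.add_apply, PiLp.sub_apply, PiLp.smul_apply]
              simp only [PiLp.single_apply, if_neg hj, smul_zero, sub_zero, add_sub_cancel_left]
              exact hDj.trans (le_add_of_nonneg_left (norm_nonneg _))
      _ = _ := integral_add hfi.norm hDi.norm
      _ ≤ δ := by linarith

/-- Removing all components of the defect one after the other. -/
theorem Subsolution.exists_stage (hd : 2 ≤ d) {p q : ℝ} (hpq : p.HolderConjugate q)
    (hen : 1 < ((d : ℝ) - 1) * (1 / 2 - q⁻¹)) {b R : Space d → Space d} {u : Space d → ℝ}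
    (h : Subsolution p b u R) {ρ η δ : ℝ}
    (hρ : ∀ i, ∫ x, |R x i| ∂(torusMeasure d) ≤ ρ / 2) (hρ0 : 0 < ρ) (hη : 0 < η) (hδ : 0 < δ) :
    ∃ (b' R' : Space d → Space d) (u' : Space d → ℝ), Subsolution p b' u' R' ∧
      eLpNorm (b' - b) (ENNReal.ofReal p) (torusMeasure d) ≤ ENNReal.ofReal η ∧
      eLpNorm (u' - u) (ENNReal.ofReal q) (torusMeasure d) ≤
        ENNReal.ofReal (2 * d ^ 2 * ρ / η) ∧
      eLpNorm (u' - u) 2 (torusMeasure d) ≤ ENNReal.ofReal δ ∧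
      eLpNorm (gradient u' - gradient u) 2 (torusMeasure d) ≤ ENNReal.ofReal δ ∧
      ∀ j, ∫ x, |R' x j| ∂(torusMeasure d) ≤ δ := by
  have hd0 : (0 : ℝ) < d := by exact_mod_cast (by omega : 0 < d)
  have hp1 : (1 : ENNReal) ≤ ENNReal.ofReal p := by simpa using hpq.lt.le
  have hq1 : (1 : ENNReal) ≤ ENNReal.ofReal q := by simpa using hpq.symm.lt.le
  set η' := η / d with hη'
  -- The bound ρ/4 ensures that a component not yet treated, initially at most ρ/2, is still below ρ
  -- when its turn comes, although earlier steps have altered it.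
  set δ' := min δ (ρ / 4) / d with hδ'
  have hη0 : 0 < η' := by positivity
  have hδ0 : 0 < δ' := by positivity
  -- S is the set of components already removed. The components outside S remain close to those of
  -- the original R.
  have key : ∀ S : Finset (Fin d), ∃ (b' R' : Space d → Space d) (u' : Space d → ℝ),
      Subsolution p b' u' R' ∧
      eLpNorm (b' - b) (ENNReal.ofReal p) (torusMeasure d) ≤ S.card * ENNReal.ofReal η' ∧
      eLpNorm (u' - u) (ENNReal.ofReal q) (torusMeasure d) ≤
        S.card * ENNReal.ofReal (2 * ρ / η') ∧
      eLpNorm (u' - u) 2 (torusMeasure d) ≤ S.card * ENNReal.ofReal δ' ∧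
      eLpNorm (gradient u' - gradient u) 2 (torusMeasure d) ≤ S.card * ENNReal.ofReal δ' ∧
      ∀ j, ∫ x, |R' x j - if j ∈ S then 0 else R x j| ∂(torusMeasure d) ≤ S.card * δ' := by
    intro S
    induction S using Finset.induction_on with
    | empty => exact ⟨b, R, u, h, by simp, by simp, by simp, by simp, by simp⟩
    | insert i S hi ih =>
      obtain ⟨b₁, R₁, u₁, h₁, hb₁, hu₁, hu₁2, hg₁, hR₁⟩ := ih
      have hcard : (S.card : ℝ) * δ' ≤ ρ / 4 := by
        have : (S.card : ℝ) ≤ d := by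
          have := S.card_le_univ
          rw [Fintype.card_fin] at this
          exact_mod_cast this
        calc (S.card : ℝ) * δ' ≤ d * δ' := by gcongr
          _ = min δ (ρ / 4) := by rw [hδ']; field_simp
          _ ≤ _ := min_le_right _ _
      have hint (j) : Integrable (fun x => R₁ x j - if j ∈ S then 0 else R x j)
          (torusMeasure d) := by
        refine (Integrable.coord h₁.integrable j).sub ?_
        split_ifs
        · exact integrable_zero _ _ _
        · exact Integrable.coord h.integrable j
      have hρ₁ : ∫ x, |R₁ x i| ∂(torusMeasure d) < ρ := by
        have h2 := hR₁ i
        have h3 := hint i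
        simp only [if_neg hi] at h2 h3
        have h4 : Integrable (fun x => |R x i|) (torusMeasure d) :=
          (Integrable.coord h.integrable i).abs
        calc _ ≤ ∫ x, (|R₁ x i - R x i| + |R x i|) ∂(torusMeasure d) := by
              refine integral_mono (Integrable.coord h₁.integrable i).abs
                (h3.abs.add h4) fun x => ?_
              have := abs_add_le (R₁ x i - R x i) (R x i)
              simpa using this
          _ = _ := integral_add h3.abs h4
          _ < ρ := by linarith [hρ i]
      obtain ⟨b₂, R₂, u₂, h₂, hb₂, hu₂, hu₂2, hg₂, hR₂⟩ :=
        h₁.exists_step hd hpq hen i hρ₁ hη0 hδ0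
      have comb {F : Type} [NormedAddCommGroup F] {f₀ f₁ f₂ : Space d → F} {r : ENNReal}
          (hr : 1 ≤ r) {c : ENNReal} (m₀ : AEStronglyMeasurable f₀ (torusMeasure d))
          (m₁ : AEStronglyMeasurable f₁ (torusMeasure d))
          (m₂ : AEStronglyMeasurable f₂ (torusMeasure d))
          (k₁ : eLpNorm (f₁ - f₀) r (torusMeasure d) ≤ S.card * c)
          (k₂ : eLpNorm (f₂ - f₁) r (torusMeasure d) ≤ c) :
          eLpNorm (f₂ - f₀) r (torusMeasure d) ≤ (insert i S).card * c := by
        rw [show f₂ - f₀ = (f₁ - f₀) + (f₂ - f₁) by abel, Finset.card_insert_of_notMem hi]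
        refine (eLpNorm_add_le (m₁.sub m₀) (m₂.sub m₁) hr).trans ?_
        push_cast
        rw [add_mul, one_mul]
        exact add_le_add k₁ k₂
      have mt {v : Space d → ℝ} (hv : IsTest v) : AEStronglyMeasurable v (torusMeasure d) :=
        hv.continuous.aestronglyMeasurable
      have mg {v : Space d → ℝ} (hv : IsTest v) :
          AEStronglyMeasurable (gradient v) (torusMeasure d) :=
        hv.continuous_gradient.aestronglyMeasurable
      refine ⟨b₂, R₂, u₂, h₂, comb hp1 h.memLp.1 h₁.memLp.1 h₂.memLp.1 hb₁ hb₂,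
        comb hq1 (mt h.test) (mt h₁.test) (mt h₂.test) hu₁ hu₂,
        comb (by norm_num) (mt h.test) (mt h₁.test) (mt h₂.test) hu₁2 hu₂2,
        comb (by norm_num) (mg h.test) (mg h₁.test) (mg h₂.test) hg₁ hg₂, fun j => ?_⟩
      have hi2 : Integrable (fun x => R₂ x j - if j = i then 0 else R₁ x j)
          (torusMeasure d) := by
        refine (Integrable.coord h₂.integrable j).sub ?_
        split_ifs
        · exact integrable_zero _ _ _
        · exact Integrable.coord h₁.integrable j
      rw [Finset.card_insert_of_notMem hi]
      calc _ ≤ ∫ x, (|R₂ x j - if j = i then 0 else R₁ x j| +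
            |R₁ x j - if j ∈ S then 0 else R x j|) ∂(torusMeasure d) := by
            refine integral_mono ?_ (hi2.abs.add (hint j).abs) fun x => ?_
            · refine Integrable.abs ((Integrable.coord h₂.integrable j).sub ?_)
              split_ifs
              · exact integrable_zero _ _ _
              · exact Integrable.coord h.integrable j
            · simp only [Finset.mem_insert]
              by_cases hji : j = i
              · simp [hji]
              · simp only [hji, false_or, if_false]
                exact abs_sub_le _ _ _
        _ = _ := integral_add hi2.abs (hint j).abs
        _ ≤ δ' + S.card * δ' := add_le_add (hR₂ j) (hR₁ j)
        _ = _ := by push_cast; ring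
  obtain ⟨b', R', u', h', hb, hu, hu2, hg, hR⟩ := key Finset.univ
  have hmul (c : ℝ) : ((Finset.univ : Finset (Fin d)).card : ENNReal) * ENNReal.ofReal c =
      ENNReal.ofReal (d * c) := by
    rw [Finset.card_univ, Fintype.card_fin, ENNReal.ofReal_mul hd0.le, ENNReal.ofReal_natCast]
  rw [hmul] at hb hu hu2 hg
  have hδ1 : d * δ' ≤ δ := by
    rw [hδ', mul_div_cancel₀ _ hd0.ne']
    exact min_le_left _ _
  refine ⟨b', R', u', h', hb.trans (ENNReal.ofReal_le_ofReal (le_of_eq ?_)),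
    hu.trans (ENNReal.ofReal_le_ofReal (le_of_eq ?_)), hu2.trans (ENNReal.ofReal_le_ofReal hδ1),
    hg.trans (ENNReal.ofReal_le_ofReal hδ1), fun j => ?_⟩
  · rw [hη']; field_simp
  · rw [hη']; field_simp
  · have := hR j
    simp only [Finset.mem_univ, if_true, sub_zero, Finset.card_univ, Fintype.card_fin] at this
    exact this.trans hδ1

/-! ### Passage to the limit -/

/-- The increments C/2/2^n sum to C; the final bound is what keeps the limit near the initial term.
-/
theorem exists_limit_of_geometric {F : Type*} [NormedAddCommGroup F] [CompleteSpace F]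
    {q : ENNReal} [Fact (1 ≤ q)] {f : ℕ → Space d → F}
    (hf : ∀ n, MemLp (f n) q (torusMeasure d)) {C : ℝ}
    (h : ∀ n, eLpNorm (f (n + 1) - f n) q (torusMeasure d) ≤ ENNReal.ofReal (C / 2 / 2 ^ n))
    (hC : 0 ≤ C) :
    ∃ l, MemLp l q (torusMeasure d) ∧
      Filter.Tendsto (fun n => eLpNorm (f n - l) q (torusMeasure d)) Filter.atTop (nhds 0) ∧
      eLpNorm (l - f 0) q (torusMeasure d) ≤ ENNReal.ofReal C := by
  set v : ℕ → Lp F q (torusMeasure d) := fun n => (hf n).toLp with hv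
  have hdist (n) : dist (v n) (v (n + 1)) ≤ C / 2 / 2 ^ n := by
    rw [dist_comm, dist_eq_norm_sub, hv, ← MemLp.toLp_sub, Lp.norm_toLp]
    exact ENNReal.toReal_le_of_le_ofReal (by positivity) (h n)
  obtain ⟨l, hl⟩ := cauchySeq_tendsto_of_complete (cauchySeq_of_le_geometric_two hdist)
  refine ⟨l, Lp.memLp l, ?_, ?_⟩
  · rw [Lp.tendsto_Lp_iff_tendsto_eLpNorm'] at hl
    refine hl.congr fun n => eLpNorm_congr_ae ?_
    filter_upwards [(hf n).coeFn_toLp] with x hx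
    simp only [Pi.sub_apply, hv, hx]
  · have h1 := dist_le_of_le_geometric_two_of_tendsto₀ hdist hl
    rw [dist_comm, Lp.dist_def] at h1
    have e : eLpNorm ((l : Space d → F) - f 0) q (torusMeasure d) =
        eLpNorm ((l : Space d → F) - (v 0 : Space d → F)) q (torusMeasure d) := by
      refine eLpNorm_congr_ae ?_
      filter_upwards [(hf 0).coeFn_toLp] with x hx
      simp only [Pi.sub_apply, hv, hx]
    rw [e]
    exact (ENNReal.le_ofReal_iff_toReal_le
      ((Lp.memLp l).sub (Lp.memLp (v 0))).eLpNorm_ne_top hC).2 h1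

theorem ae_eq_of_tendsto_eLpNorm {F : Type*} [NormedAddCommGroup F] {q : ENNReal} (hq : 1 ≤ q)
    {f : ℕ → Space d → F} {l l' : Space d → F}
    (hf : ∀ n, AEStronglyMeasurable (f n) (torusMeasure d))
    (hl : AEStronglyMeasurable l (torusMeasure d)) (hl' : AEStronglyMeasurable l' (torusMeasure d))
    (h : Filter.Tendsto (fun n => eLpNorm (f n - l) q (torusMeasure d)) Filter.atTop (nhds 0))
    (h' : Filter.Tendsto (fun n => eLpNorm (f n - l') q (torusMeasure d)) Filter.atTop (nhds 0)) :
    l =ᵐ[torusMeasure d] l' := by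
  have h1 := h.add h'
  rw [add_zero] at h1
  have h2 : eLpNorm (l - l') q (torusMeasure d) ≤ 0 := by
    refine ge_of_tendsto' h1 fun n => ?_
    rw [show l - l' = (f n - l') - (f n - l) by abel, add_comm]
    exact eLpNorm_sub_le ((hf n).sub hl') ((hf n).sub hl) hq
  have h3 := (eLpNorm_eq_zero_iff (hl.sub hl') (by positivity)).1 (le_antisymm h2 bot_le)
  filter_upwards [h3] with x hx
  exact sub_eq_zero.1 hx

theorem tendsto_integral_mul {f : ℕ → Space d → ℝ} {l χ : Space d → ℝ}
    (hf : ∀ n, Integrable (f n) (torusMeasure d)) (hl : Integrable l (torusMeasure d))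
    (h : Filter.Tendsto (fun n => eLpNorm (f n - l) 1 (torusMeasure d)) Filter.atTop (nhds 0))
    (hχ : Continuous χ) :
    Filter.Tendsto (fun n => ∫ x, f n x * χ x ∂(torusMeasure d)) Filter.atTop
      (nhds (∫ x, l x * χ x ∂(torusMeasure d))) := by
  obtain ⟨C, hC0, hC⟩ := exists_bound_cube hχ
  refine tendsto_integral_of_L1' _ ?_ (Filter.Eventually.of_forall fun n => ?_) ?_
  · exact (hl.mul_bdd hχ.aestronglyMeasurable (ae_mem_cube.mono hC)).1
  · exact (hf n).mul_bdd hχ.aestronglyMeasurable (ae_mem_cube.mono hC)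
  · have h2 := ENNReal.Tendsto.const_mul (a := ENNReal.ofReal C) h (Or.inr (by simp))
    rw [mul_zero] at h2
    refine tendsto_of_tendsto_of_tendsto_of_le_of_le tendsto_const_nhds h2 (fun _ => zero_le)
      fun n => ?_
    refine eLpNorm_le_const_mul 1 fun x hx => ?_
    rw [Pi.sub_apply, ← sub_mul, norm_mul, mul_comm]
    exact mul_le_mul_of_nonneg_right (hC x hx) (norm_nonneg _)

theorem tendsto_eLpNorm_of_exponent_le {F : Type*} [NormedAddCommGroup F] {p q : ENNReal}
    (hpq : p ≤ q) {f : ℕ → Space d → F} {l : Space d → F}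
    (hf : ∀ n, AEStronglyMeasurable (f n) (torusMeasure d))
    (hl : AEStronglyMeasurable l (torusMeasure d))
    (h : Filter.Tendsto (fun n => eLpNorm (f n - l) q (torusMeasure d)) Filter.atTop (nhds 0)) :
    Filter.Tendsto (fun n => eLpNorm (f n - l) p (torusMeasure d)) Filter.atTop (nhds 0) :=
  tendsto_of_tendsto_of_tendsto_of_le_of_le tendsto_const_nhds h (fun _ => zero_le)
    fun n => eLpNorm_le_eLpNorm_of_exponent_le hpq ((hf n).sub hl)

/-- The weak gradient is closed under `L^2` limits of smooth functions. -/
theorem isWeakGradient_of_tendsto {u : ℕ → Space d → ℝ} {v : Space d → ℝ} {g : Space d → Space d}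
    (hu : ∀ n, IsTest (u n)) (hv : MemLp v 2 (torusMeasure d)) (hg : MemLp g 2 (torusMeasure d))
    (huv : Filter.Tendsto (fun n => eLpNorm (u n - v) 2 (torusMeasure d)) Filter.atTop (nhds 0))
    (hug : Filter.Tendsto (fun n => eLpNorm (gradient (u n) - g) 2 (torusMeasure d))
      Filter.atTop (nhds 0)) : IsWeakGradient v g := by
  intro φ hφ i
  have hvi := integrable_of_memLp (by norm_num) hv
  have hgi := integrable_of_memLp (by norm_num) hg
  have t1 := tendsto_integral_mul (fun n => (hu n).integrable) hvi
    (tendsto_eLpNorm_of_exponent_le (by norm_num)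
      (fun n => (hu n).continuous.aestronglyMeasurable) hv.1 huv) (hφ.pd i).continuous
  have hgr (n) := (hu n).continuous_gradient
  have hcoord : Filter.Tendsto (fun n => eLpNorm (pd i (u n) - fun x => g x i) 1
      (torusMeasure d)) Filter.atTop (nhds 0) := by
    refine tendsto_of_tendsto_of_tendsto_of_le_of_le tendsto_const_nhds
      (tendsto_eLpNorm_of_exponent_le (p := 1) (by norm_num)
        (fun n => (hgr n).aestronglyMeasurable) hg.1 hug) (fun _ => zero_le) fun n => ?_
    refine eLpNorm_mono fun x => ?_
    simp only [Pi.sub_apply, ← gradient_apply]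
    exact PiLp.norm_apply_le (gradient (u n) x - g x) i
  have t2 := tendsto_integral_mul (fun n => ((hu n).pd i).integrable) (Integrable.coord hgi i)
    hcoord hφ.continuous
  have t3 := t2.neg
  refine tendsto_nhds_unique (t1.congr fun n => ?_) t3
  exact integral_mul_pd (hu n) hφ i

/-- A weak solution up to an additive constant yields a zero-mean solution. -/
theorem isSolution_sub_mean {p : ℝ} (hp : 1 < p) {b : Space d → Space d} {u : Space d → ℝ}
    {g : Space d → Space d} (hb : MemLp b (ENNReal.ofReal p) (torusMeasure d)) (hbd : IsDivFree b)
    (hu2 : MemLp u 2 (torusMeasure d))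
    (hu : MemLp u (ENNReal.ofReal p.conjExponent) (torusMeasure d))
    (hg2 : MemLp g 2 (torusMeasure d)) (hug : IsWeakGradient u g)
    (heq : IsDivFree fun x => g x + u x • b x) :
    IsSolution p b fun x => u x - ∫ y, u y ∂(torusMeasure d) := by
  set c := ∫ y, u y ∂(torusMeasure d) with hc
  have hpq : p.HolderConjugate p.conjExponent := Real.HolderConjugate.conjExponent hp
  have hui := integrable_of_memLp (by norm_num) hu2
  have hgi := integrable_of_memLp (by norm_num) hg2
  have hbi := integrable_of_memLp (by simpa using hp.le) hb
  have hubi : Integrable (fun x => u x • b x) (torusMeasure d) := by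
    have := holderTriple_ofReal hpq
    exact memLp_one_iff_integrable.1 (hb.smul hu)
  have hmul {χ : Space d → ℝ} (hχ : Continuous χ) {v : Space d → ℝ}
      (hv : Integrable v (torusMeasure d)) : Integrable (fun x => v x * χ x) (torusMeasure d) := by
    obtain ⟨C, -, hC⟩ := exists_bound_cube hχ
    exact hv.mul_bdd hχ.aestronglyMeasurable (ae_mem_cube.mono hC)
  refine ⟨⟨hu2.sub (memLp_const c), g, hg2, fun φ hφ i => ?_⟩, hu.sub (memLp_const c), ?_, ?_⟩
  · rw [← hug φ hφ i]
    have h1 := integral_pd_eq_zero hφ i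
    change ∫ x, (u x - c) * pd i φ x ∂(torusMeasure d) = ∫ x, u x * pd i φ x ∂(torusMeasure d)
    simp only [sub_mul]
    rw [integral_sub (hmul (hφ.pd i).continuous hui) (((hφ.pd i).integrable).const_mul c),
      integral_const_mul, h1]
    ring
  · unfold HasZeroMean
    rw [integral_sub hui (integrable_const c)]
    simp [hc]
  · intro φ hφ _
    have hΔ : Continuous fun x => ∑ k, pd k (pd k φ) x :=
      continuous_finsetSum _ fun k _ => ((hφ.pd k).pd k).continuous
    have hgr := hφ.continuous_gradient
    have i1 := hmul hΔ hui
    have i2 := integrable_inner_of_continuous hubi hgr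
    have i3 := integrable_of_continuous hΔ
    have i4 := integrable_inner_of_continuous hbi hgr
    -- The subtracted constant contributes c∫Δφ and c∫b·∇φ. The first vanishes by periodicity and
    -- the second because b is divergence-free.
    have e (x : Space d) : -((u x - c) * Laplacian.laplacian φ x) +
        (u x - c) * inner ℝ (b x) (gradient φ x) =
        (-(u x * ∑ k, pd k (pd k φ) x) + inner ℝ (u x • b x) (gradient φ x)) +
        (c * ∑ k, pd k (pd k φ) x - c * inner ℝ (b x) (gradient φ x)) := by
      rw [laplacian_eq_sum_pd hφ, real_inner_smul_left]; ring
    have z1 : ∫ x, ∑ k, pd k (pd k φ) x ∂(torusMeasure d) = 0 := by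
      rw [integral_finsetSum _ fun k _ => ((hφ.pd k).pd k).integrable]
      exact Finset.sum_eq_zero fun k _ => integral_pd_eq_zero (hφ.pd k) k
    have z2 : ∫ x, u x * ∑ k, pd k (pd k φ) x ∂(torusMeasure d) =
        -∫ x, inner ℝ (g x) (gradient φ x) ∂(torusMeasure d) := by
      simp only [Finset.mul_sum, inner_gradient_eq_sum]
      rw [integral_finsetSum _ fun k _ => hmul ((hφ.pd k).pd k).continuous hui,
        integral_finsetSum _ fun k _ => hmul (hφ.pd k).continuous (Integrable.coord hgi k),
        ← Finset.sum_neg_distrib]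
      exact Finset.sum_congr rfl fun k _ => hug (pd k φ) (hφ.pd k) k
    have z3 := heq φ hφ
    simp only [inner_add_left] at z3
    rw [integral_add (integrable_inner_of_continuous hgi hgr) i2] at z3
    simp only [e]
    have i5 : Integrable (fun x => -(u x * ∑ k, pd k (pd k φ) x)) (torusMeasure d) := i1.neg
    have i6 : Integrable (fun x => -(u x * ∑ k, pd k (pd k φ) x) +
        inner ℝ (u x • b x) (gradient φ x)) (torusMeasure d) := i5.add i2
    have i7 : Integrable (fun x => c * ∑ k, pd k (pd k φ) x -
        c * inner ℝ (b x) (gradient φ x)) (torusMeasure d) := (i3.const_mul c).sub (i4.const_mul c)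
    rw [integral_add i6 i7, integral_add i5 i2, integral_sub (i3.const_mul c) (i4.const_mul c), integral_neg,
      integral_const_mul, integral_const_mul, z1, hbd φ hφ, z2]
    linarith

/-- A smooth function at a definite `L^2` distance from the constants. -/
theorem exists_isTest_far_from_const (i : Fin d) :
    ∃ u : Space d → ℝ, IsTest u ∧
      ∀ c : ℝ, ENNReal.ofReal (1 / 2) < eLpNorm (fun x => c - u x) 2 (torusMeasure d) := by
  have hcos (N : ℕ) (hN : 0 < N) : ∫ x : Space d, Real.cos (2 * Real.pi * N * x i)
      ∂(torusMeasure d) = 0 := by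
    have hN' : (N : ℝ) ≠ 0 := by positivity
    set f : ℝ → ℝ := fun t => (2 * Real.pi * N)⁻¹ * Real.sin (2 * Real.pi * N * t) with hf
    have hfs : ContDiff ℝ (⊤ : ℕ∞) f := by fun_prop
    have hfp : Function.Periodic f 1 := fun t => by
      simp only [hf]
      rw [show 2 * Real.pi * N * (t + 1) = 2 * Real.pi * N * t + N * (2 * Real.pi) by ring,
        Real.sin_add_nat_mul_two_pi]
    have hfd (t) : deriv f t = Real.cos (2 * Real.pi * N * t) := by
      have h0 : HasDerivAt (fun r : ℝ => 2 * Real.pi * N * r) (2 * Real.pi * N) t := by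
        simpa using (hasDerivAt_id t).const_mul (2 * Real.pi * N)
      have h1 := (((Real.hasDerivAt_sin _).comp t h0).const_mul (2 * Real.pi * N)⁻¹).deriv
      refine Eq.trans h1 ?_
      have := Real.pi_pos
      field_simp
    have h := integral_pd_eq_zero (IsTest.coord hfs hfp i) i
    simp only [pd_coord (hfs.differentiable (by simp)), if_true, hfd] at h
    exact h
  have hu : IsTest fun x : Space d => Real.cos (2 * Real.pi * x i) :=
    IsTest.coord (f := fun t => Real.cos (2 * Real.pi * t)) (by fun_prop)
      (fun t => by simp [mul_add]) i
  have hu2 : IsTest fun x : Space d => Real.cos (2 * Real.pi * (2 : ℕ) * x i) :=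
    IsTest.coord (f := fun t => Real.cos (2 * Real.pi * (2 : ℕ) * t)) (by fun_prop)
      (fun t => by
        simp only
        rw [show 2 * Real.pi * (2 : ℕ) * (t + 1) =
          2 * Real.pi * (2 : ℕ) * t + (2 : ℕ) * (2 * Real.pi) by ring,
          Real.cos_add_nat_mul_two_pi]) i
  refine ⟨_, hu, fun c => ?_⟩
  rw [eLpNorm_two_eq_ofReal_sqrt ((IsTest.const c).sub hu).continuous]
  -- The cosine has mean zero and its square has mean 1/2, so the squared distance to c is c² + 1/2,
  -- which exceeds 1/4.
  have e (x : Space d) : (c - Real.cos (2 * Real.pi * x i)) ^ 2 =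
      (c ^ 2 + 1 / 2) + (1 / 2 * Real.cos (2 * Real.pi * (2 : ℕ) * x i) -
        2 * c * Real.cos (2 * Real.pi * x i)) := by
    have : Real.cos (2 * Real.pi * (2 : ℕ) * x i) = 2 * Real.cos (2 * Real.pi * x i) ^ 2 - 1 := by
      rw [← Real.cos_two_mul]; push_cast; ring_nf
    rw [this]; ring
  have h1 := hcos 1 one_pos
  have h2 := hcos 2 two_pos
  simp only [Nat.cast_one, mul_one] at h1
  simp only [e]
  rw [integral_add (integrable_const _)
    ((hu2.const_mul (1 / 2)).sub (hu.const_mul (2 * c))).integrable, integral_sub (hu2.integrable.const_mul _)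
    (hu.integrable.const_mul _), integral_const_mul, integral_const_mul, h1, h2]
  simp only [integral_const, probReal_univ, one_smul, mul_zero, sub_zero, add_zero]
  refine (ENNReal.ofReal_lt_ofReal_iff_of_nonneg (by norm_num)).2 ?_
  exact Real.lt_sqrt_of_sq_lt (by nlinarith [sq_nonneg c])

/-- Hölder is applied to u_n b_n - v c = (u_n - v)(b_n - c) + (u_n - v)c + v(b_n - c). Strong
convergence in the dual pair L^q, L^p is what passes the product to the limit. -/
theorem tendsto_eLpNorm_smul_sub {p q : ℝ} (hpq : p.HolderConjugate q) {u : ℕ → Space d → ℝ}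
    {v : Space d → ℝ} {b : ℕ → Space d → Space d} {c : Space d → Space d}
    (hu : ∀ n, AEStronglyMeasurable (u n) (torusMeasure d))
    (hv : MemLp v (ENNReal.ofReal q) (torusMeasure d))
    (hb : ∀ n, AEStronglyMeasurable (b n) (torusMeasure d))
    (hc : MemLp c (ENNReal.ofReal p) (torusMeasure d))
    (huv : Filter.Tendsto (fun n => eLpNorm (u n - v) (ENNReal.ofReal q) (torusMeasure d))
      Filter.atTop (nhds 0))
    (hbc : Filter.Tendsto (fun n => eLpNorm (b n - c) (ENNReal.ofReal p) (torusMeasure d))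
      Filter.atTop (nhds 0)) :
    Filter.Tendsto (fun n => eLpNorm ((fun x => u n x • b n x) - fun x => v x • c x) 1
      (torusMeasure d)) Filter.atTop (nhds 0) := by
  have t1 := ENNReal.Tendsto.mul huv (Or.inr (by simp)) hbc (Or.inr (by simp))
  have t2 := ENNReal.Tendsto.mul_const (b := eLpNorm c (ENNReal.ofReal p) (torusMeasure d)) huv
    (Or.inr hc.2.ne)
  have t3 := ENNReal.Tendsto.const_mul (a := eLpNorm v (ENNReal.ofReal q) (torusMeasure d)) hbc
    (Or.inr hv.2.ne)
  have t := (t1.add t2).add t3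
  simp only [mul_zero, zero_mul, add_zero] at t
  refine tendsto_of_tendsto_of_tendsto_of_le_of_le tendsto_const_nhds t (fun _ => zero_le)
    fun n => ?_
  have m1 := (hu n).sub hv.1
  have m2 := (hb n).sub hc.1
  have e : ((fun x => u n x • b n x) - fun x => v x • c x) =
      ((fun x => (u n - v) x • (b n - c) x) + fun x => (u n - v) x • c x) +
        fun x => v x • (b n - c) x := by
    funext x
    simp only [Pi.sub_apply, Pi.add_apply]
    module
  rw [e]
  refine (eLpNorm_add_le ((m1.smul m2).add (m1.smul hc.1)) (hv.1.smul m2) le_rfl).trans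
    (add_le_add ((eLpNorm_add_le (m1.smul m2) (m1.smul hc.1) le_rfl).trans (add_le_add ?_ ?_)) ?_)
  · exact eLpNorm_smul_le_of_holder hpq m1 m2
  · exact eLpNorm_smul_le_of_holder hpq m1 hc.1
  · exact eLpNorm_smul_le_of_holder hpq hv.1 m2

/-! ### The iteration and its limit -/

theorem exists_subsolution_sequence (hd : 2 ≤ d) {p q : ℝ} (hpq : p.HolderConjugate q)
    (hen : 1 < ((d : ℝ) - 1) * (1 / 2 - q⁻¹)) {b₀ : Space d → Space d}
    (hb₀ : MemLp b₀ (ENNReal.ofReal p) (torusMeasure d)) (hdiv : IsDivFree b₀)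
    {u₀ : Space d → ℝ} (hu₀ : IsTest u₀) {ε : ℝ} (hε : 0 < ε) :
    ∃ (b R : ℕ → Space d → Space d) (u : ℕ → Space d → ℝ),
      (∀ n, Subsolution p (b n) (u n) (R n)) ∧
      (∀ n i, ∫ x, |R n x i| ∂(torusMeasure d) ≤ (1 / 4) ^ n / 2) ∧
      eLpNorm (b 0 - b₀) (ENNReal.ofReal p) (torusMeasure d) ≤ ENNReal.ofReal (ε / 2) ∧
      eLpNorm (u 0 - u₀) 2 (torusMeasure d) ≤ ENNReal.ofReal (1 / 8) ∧
      (∀ n, eLpNorm (b (n + 1) - b n) (ENNReal.ofReal p) (torusMeasure d) ≤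
        ENNReal.ofReal (ε / 2 / 2 / 2 ^ n)) ∧
      (∀ n, eLpNorm (u (n + 1) - u n) (ENNReal.ofReal q) (torusMeasure d) ≤
        ENNReal.ofReal (16 * d ^ 2 / ε / 2 / 2 ^ n)) ∧
      (∀ n, eLpNorm (u (n + 1) - u n) 2 (torusMeasure d) ≤
        ENNReal.ofReal (1 / 4 / 2 / 2 ^ n)) ∧
      ∀ n, eLpNorm (gradient (u (n + 1)) - gradient (u n)) 2 (torusMeasure d) ≤
        ENNReal.ofReal (1 / 4 / 2 / 2 ^ n) := by
  have hb₀i := integrable_of_memLp (by simpa using hpq.lt.le) hb₀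
  have hub : Integrable (fun x => u₀ x • b₀ x) (torusMeasure d) := by
    have := holderTriple_ofReal hpq
    exact memLp_one_iff_integrable.1
      (hb₀.smul (memLp_of_continuous hu₀.continuous (ENNReal.ofReal q)))
  -- Any smooth u₀ is an approximate solution when the whole flux is declared to be the defect.
  have h₀ : Subsolution p b₀ u₀ fun x => gradient u₀ x + u₀ x • b₀ x :=
    ⟨hb₀, hdiv, hu₀, (integrable_of_continuous hu₀.continuous_gradient).add hub,
      fun φ _ => by simp⟩
  have hs (i : Fin d) : ∫ x, |(gradient u₀ x + u₀ x • b₀ x) i| ∂(torusMeasure d) ≤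
      (2 * (1 + ∑ j, ∫ x, |(gradient u₀ x + u₀ x • b₀ x) j| ∂(torusMeasure d))) / 2 := by
    have := Finset.single_le_sum (f := fun j =>
      ∫ x, |(gradient u₀ x + u₀ x • b₀ x) j| ∂(torusMeasure d))
      (fun j _ => integral_nonneg fun x => abs_nonneg _) (Finset.mem_univ i)
    simp only at this
    linarith
  have hpos : 0 < 2 * (1 + ∑ j, ∫ x, |(gradient u₀ x + u₀ x • b₀ x) j| ∂(torusMeasure d)) := by
    have : 0 ≤ ∑ j, ∫ x, |(gradient u₀ x + u₀ x • b₀ x) j| ∂(torusMeasure d) :=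
      Finset.sum_nonneg fun j _ => integral_nonneg fun x => abs_nonneg _
    linarith
  -- The initial defect may be large. Its removal still costs only ε/2 in the drift and 1/8 in L^2;
  -- the possibly huge L^q change of u is discarded, since only later increments have to be
  -- summable.
  obtain ⟨b₁, R₁, u₁, h₁, hb₁, -, hu₁, -, hR₁⟩ :=
    h₀.exists_stage hd hpq hen hs hpos (half_pos hε) (by norm_num : (0 : ℝ) < 1 / 8)
  let X (n : ℕ) := {s : (Space d → Space d) × (Space d → Space d) × (Space d → ℝ) //
    Subsolution p s.1 s.2.2 s.2.1 ∧ ∀ i, ∫ x, |s.2.1 x i| ∂(torusMeasure d) ≤ (1 / 4) ^ n / 2}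
  have step (n : ℕ) (s : X n) : ∃ t : X (n + 1),
      eLpNorm (t.1.1 - s.1.1) (ENNReal.ofReal p) (torusMeasure d) ≤
        ENNReal.ofReal (ε / 2 / 2 / 2 ^ n) ∧
      eLpNorm (t.1.2.2 - s.1.2.2) (ENNReal.ofReal q) (torusMeasure d) ≤
        ENNReal.ofReal (16 * d ^ 2 / ε / 2 / 2 ^ n) ∧
      eLpNorm (t.1.2.2 - s.1.2.2) 2 (torusMeasure d) ≤ ENNReal.ofReal (1 / 4 / 2 / 2 ^ n) ∧
      eLpNorm (gradient t.1.2.2 - gradient s.1.2.2) 2 (torusMeasure d) ≤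
        ENNReal.ofReal (1 / 4 / 2 / 2 ^ n) := by
    -- Here ρ = 4^(-n) and η = ε/4 · 2^(-n). The L^q increment 2d²ρ/η = 8d²/ε · 2^(-n) is then
    -- summable along with η, because the defect decays faster than the drift increments.
    obtain ⟨b, R, u, h, hb, huq, hu, hg, hR⟩ := s.2.1.exists_stage hd hpq hen s.2.2
      (by positivity) (by positivity : 0 < ε / 2 / 2 / 2 ^ n)
      (by positivity : (0 : ℝ) < (1 / 4) ^ (n + 1) / 2)
    have h42 : (4 : ℝ) ^ n = 2 ^ n * 2 ^ n := by rw [← mul_pow]; norm_num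
    have hδ : (1 / 4 : ℝ) ^ (n + 1) / 2 ≤ 1 / 4 / 2 / 2 ^ n := by
      rw [one_div_pow, pow_succ, h42, div_div, div_div, div_div]
      refine one_div_le_one_div_of_le (by positivity) ?_
      have : (1 : ℝ) ≤ 2 ^ n := one_le_pow₀ (by norm_num)
      nlinarith
    refine ⟨⟨(b, R, u), h, hR⟩, hb, huq.trans (ENNReal.ofReal_le_ofReal (le_of_eq ?_)),
      hu.trans (ENNReal.ofReal_le_ofReal hδ), hg.trans (ENNReal.ofReal_le_ofReal hδ)⟩
    rw [one_div_pow, h42]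
    field_simp
    norm_num
  choose f hf using step
  let s₁ : X 0 := ⟨(b₁, R₁, u₁), h₁, fun i => (hR₁ i).trans (by norm_num)⟩
  let s (n : ℕ) : X n := Nat.rec (motive := X) s₁ f n
  have hsucc (n) : s (n + 1) = f n (s n) := rfl
  refine ⟨fun n => (s n).1.1, fun n => (s n).1.2.1, fun n => (s n).1.2.2, fun n => (s n).2.1,
    fun n => (s n).2.2, hb₁, hu₁, fun n => ?_, fun n => ?_, fun n => ?_, fun n => ?_⟩
  · exact (hf n (s n)).1
  · exact (hf n (s n)).2.1
  · exact (hf n (s n)).2.2.1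
  · exact (hf n (s n)).2.2.2

/-- Arbitrarily close to any divergence-free drift there is one with a nontrivial solution. -/
theorem exists_drift_near (hd : 2 ≤ d) {p : ℝ} (hp : 1 < p)
    (hen : 1 < ((d : ℝ) - 1) * (1 / 2 - p.conjExponent⁻¹)) {b₀ : Space d → Space d}
    (hb₀ : MemLp b₀ (ENNReal.ofReal p) (torusMeasure d)) (hdiv : IsDivFree b₀) {ε : ℝ}
    (hε : 0 < ε) :
    ∃ (b : Space d → Space d) (v : Space d → ℝ), MemLp b (ENNReal.ofReal p) (torusMeasure d) ∧
      IsDivFree b ∧ eLpNorm (b - b₀) (ENNReal.ofReal p) (torusMeasure d) ≤ ENNReal.ofReal ε ∧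
      IsSolution p b v ∧ ¬ v =ᵐ[torusMeasure d] 0 := by
  have hpq : p.HolderConjugate p.conjExponent := Real.HolderConjugate.conjExponent hp
  set q := p.conjExponent with hq
  have hp1 : (1 : ENNReal) ≤ ENNReal.ofReal p := by simpa using hp.le
  have hq1 : (1 : ENNReal) ≤ ENNReal.ofReal q := by simpa using hpq.symm.lt.le
  have : Fact (1 ≤ ENNReal.ofReal p) := ⟨hp1⟩
  have : Fact (1 ≤ ENNReal.ofReal q) := ⟨hq1⟩
  have hq2 : (2 : ENNReal) ≤ ENNReal.ofReal q := by
    have h1 : 0 < 1 / 2 - q⁻¹ := by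
      by_contra h
      have : (2 : ℝ) ≤ d := by exact_mod_cast hd
      nlinarith
    have hq0 := hpq.symm.pos
    have h2 : q⁻¹ < 2⁻¹ := by linarith
    have h3 : 2 < q := (inv_lt_inv₀ hq0 two_pos).1 h2
    rw [show (2 : ENNReal) = ENNReal.ofReal 2 by simp]
    exact ENNReal.ofReal_le_ofReal h3.le
  obtain ⟨u₀, hu₀, hfar⟩ := exists_isTest_far_from_const (⟨0, by omega⟩ : Fin d)
  obtain ⟨b, R, u, hsub, hR, hb0, hu0, hb, huq, hu2, hg⟩ :=
    exists_subsolution_sequence hd hpq hen hb₀ hdiv hu₀ hε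
  have hut (n) := (hsub n).test
  have hum (n) : AEStronglyMeasurable (u n) (torusMeasure d) :=
    (hut n).continuous.aestronglyMeasurable
  obtain ⟨c, hc, hbc, hc0⟩ := exists_limit_of_geometric (fun n => (hsub n).memLp) hb
    (by positivity)
  obtain ⟨v, hv, huv, -⟩ := exists_limit_of_geometric
    (fun n => memLp_of_continuous (hut n).continuous _) huq (by positivity)
  -- The L^q increments total up to 16d²/ε, which says nothing about closeness to u₀. The L^2 limit
  -- is therefore taken separately, with total increment 1/4, and identified with v.
  obtain ⟨v', hv', huv', hv0⟩ := exists_limit_of_geometric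
    (fun n => memLp_of_continuous (hut n).continuous _) hu2 (by positivity)
  obtain ⟨g, hgm, hug, -⟩ := exists_limit_of_geometric
    (fun n => memLp_of_continuous (hut n).continuous_gradient _) hg (by positivity)
  have huv2 := tendsto_eLpNorm_of_exponent_le hq2 hum hv.1 huv
  have hv2 : MemLp v 2 (torusMeasure d) := hv.mono_exponent hq2
  have hvv : v =ᵐ[torusMeasure d] v' :=
    ae_eq_of_tendsto_eLpNorm (by norm_num) hum hv.1 hv'.1 huv2 huv'
  have hbi (n) := integrable_of_memLp hp1 (hsub n).memLp
  have hci := integrable_of_memLp hp1 hc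
  have hholder := holderTriple_ofReal hpq
  have hvc : Integrable (fun x => v x • c x) (torusMeasure d) :=
    memLp_one_iff_integrable.1 (hc.smul hv)
  have hubi (n) : Integrable (fun x => u n x • b n x) (torusMeasure d) :=
    memLp_one_iff_integrable.1
      ((hsub n).memLp.smul (memLp_of_continuous (hut n).continuous (ENNReal.ofReal q)))
  have hgi := integrable_of_memLp (by norm_num) hgm
  have hgr (n) := integrable_of_continuous (hut n).continuous_gradient
  have hcd : IsDivFree c := IsDivFree.of_tendsto (fun n => (hsub n).divFree) hbi hci
    (tendsto_eLpNorm_of_exponent_le hp1 (fun n => (hsub n).memLp.1) hc.1 hbc)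
  have hRt : Filter.Tendsto (fun n => eLpNorm (R n) 1 (torusMeasure d)) Filter.atTop
      (nhds 0) := by
    have t : Filter.Tendsto (fun n : ℕ => ENNReal.ofReal (d * ((1 / 4) ^ n / 2))) Filter.atTop
        (nhds 0) := by
      have := ((tendsto_pow_atTop_nhds_zero_of_lt_one (r := (1 / 4 : ℝ)) (by norm_num)
        (by norm_num)).div_const 2).const_mul (d : ℝ)
      simpa using ENNReal.tendsto_ofReal this
    refine tendsto_of_tendsto_of_tendsto_of_le_of_le tendsto_const_nhds t (fun _ => zero_le)
      fun n => ?_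
    refine (eLpNorm_le_sum_coord (hsub n).integrable.1 le_rfl).trans ?_
    calc _ ≤ ∑ _k : Fin d, ENNReal.ofReal ((1 / 4) ^ n / 2) := by
          refine Finset.sum_le_sum fun k _ => ?_
          rw [eLpNorm_one_eq_ofReal_integral (Integrable.coord (hsub n).integrable k)]
          exact ENNReal.ofReal_le_ofReal (hR n k)
      _ = _ := by
          rw [Finset.sum_const, Finset.card_univ, Fintype.card_fin, nsmul_eq_mul,
            ENNReal.ofReal_mul (by positivity), ENNReal.ofReal_natCast]
  have heq : IsDivFree fun x => g x + v x • c x := by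
    refine IsDivFree.of_tendsto (fun n => (hsub n).eqn)
      (fun n => ((hgr n).add (hubi n)).sub (hsub n).integrable) (hgi.add hvc) ?_
    have t := ((tendsto_eLpNorm_of_exponent_le (p := 1) (by norm_num) (fun n => (hgr n).1) hgm.1
      hug).add (tendsto_eLpNorm_smul_sub hpq hum hv (fun n => (hbi n).1) hc huv hbc)).add hRt
    simp only [add_zero] at t
    refine tendsto_of_tendsto_of_tendsto_of_le_of_le tendsto_const_nhds t (fun _ => zero_le)
      fun n => ?_
    have e : ((fun x => gradient (u n) x + u n x • b n x - R n x) - fun x => g x + v x • c x) =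
        ((gradient (u n) - g) + ((fun x => u n x • b n x) - fun x => v x • c x)) - R n := by
      funext x
      simp only [Pi.sub_apply, Pi.add_apply]
      abel
    rw [e]
    exact (eLpNorm_sub_le (((hgr n).sub hgi).add ((hubi n).sub hvc)).1 (hsub n).integrable.1
      le_rfl).trans (add_le_add (eLpNorm_add_le ((hgr n).sub hgi).1 ((hubi n).sub hvc).1 le_rfl)
      le_rfl)
  refine ⟨c, _, hc, hcd, ?_, isSolution_sub_mean hp hc hcd hv2 hv hgm
    (isWeakGradient_of_tendsto hut hv2 hgm huv2 hug) heq, fun hzero => ?_⟩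
  · rw [show c - b₀ = (c - b 0) + (b 0 - b₀) by abel]
    refine (eLpNorm_add_le (hc.1.sub (hsub 0).memLp.1) ((hsub 0).memLp.1.sub hb₀.1) hp1).trans ?_
    refine (add_le_add hc0 hb0).trans (le_of_eq ?_)
    rw [← ENNReal.ofReal_add (by positivity) (by positivity), add_halves]
  · set m := ∫ y, v y ∂(torusMeasure d) with hm
    -- If v were equal to its mean m, then u₀ would be within 1/4 + 1/8 < 1/2 of a constant in L^2.
    refine absurd (hfar m) (not_lt.2 ?_)
    have e : (fun x => m - u₀ x) =ᵐ[torusMeasure d] (v' - u 0) + (u 0 - u₀) := by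
      filter_upwards [hzero, hvv] with x hx hx'
      have hx2 : v x - m = 0 := hx
      simp only [Pi.add_apply, Pi.sub_apply, ← hx']
      linarith
    rw [eLpNorm_congr_ae e]
    refine (eLpNorm_add_le (hv'.1.sub (hum 0))
      ((hum 0).sub hu₀.continuous.aestronglyMeasurable) (by norm_num)).trans ?_
    refine (add_le_add hv0 hu0).trans ?_
    rw [← ENNReal.ofReal_add (by norm_num) (by norm_num)]
    exact ENNReal.ofReal_le_ofReal (by norm_num)

theorem IsSolution.congr_ae {p : ℝ} {b c : Space d → Space d} {u : Space d → ℝ}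
    (h : IsSolution p b u) (hbc : b =ᵐ[torusMeasure d] c) : IsSolution p c u := by
  refine ⟨h.memH1, h.memLp, h.zeroMean, fun φ hφ hm => ?_⟩
  rw [← h.weak φ hφ hm]
  refine integral_congr_ae ?_
  filter_upwards [hbc] with x hx
  rw [hx]

theorem isSolution_zero {p : ℝ} (b : Space d → Space d) : IsSolution p b 0 := by
  refine ⟨⟨MemLp.zero, 0, MemLp.zero, fun φ _ i => by simp⟩, MemLp.zero, by simp [HasZeroMean],
    fun φ _ _ => by simp⟩

end TorusDrift

end

theorem theorem2 (d : ℕ) (hd : 4 ≤ d) (p : ℝ) (hp1 : 1 < p)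
    (hp2 : p < 2 * ((d : ℝ) - 1) / ((d : ℝ) + 1)) [Fact (1 ≤ ENNReal.ofReal p)] :
    (∀ b₀ ∈ TorusDrift.divFreeDrifts d p, ∀ ε : ℝ, 0 < ε →
      ∃ b ∈ TorusDrift.divFreeDrifts d p, ‖b - b₀‖ ≤ ε ∧
        ∃ u : TorusDrift.Space d → ℝ, TorusDrift.IsSolution p b u ∧
          ¬ u =ᵐ[TorusDrift.torusMeasure d] 0) ∧
    Dense {b : TorusDrift.divFreeDrifts d p |
      TorusDrift.HasNonuniqueness p (b.1 : TorusDrift.Space d → TorusDrift.Space d)} := by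
  -- With 1/q = 1 - 1/p the condition reads 1/p - 1/2 > 1/(d-1), that is, 1/p > (d+1)/(2(d-1)).
  have hen : 1 < ((d : ℝ) - 1) * (1 / 2 - p.conjExponent⁻¹) := by
    have hpq : p.HolderConjugate p.conjExponent := Real.HolderConjugate.conjExponent hp1
    have h1 := hpq.inv_add_inv_eq_one
    have hd0 : (4 : ℝ) ≤ d := by exact_mod_cast hd
    have hp0 : 0 < p := hpq.pos
    rw [show p.conjExponent⁻¹ = 1 - p⁻¹ by linarith]
    rw [lt_div_iff₀ (by linarith)] at hp2
    have h2 : ((d : ℝ) + 1) < 2 * ((d : ℝ) - 1) * p⁻¹ := by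
      rw [← div_eq_mul_inv, lt_div_iff₀ hp0]
      linarith
    nlinarith
  have main : ∀ b₀ ∈ TorusDrift.divFreeDrifts d p, ∀ ε : ℝ, 0 < ε →
      ∃ b ∈ TorusDrift.divFreeDrifts d p, ‖b - b₀‖ ≤ ε ∧
        ∃ u : TorusDrift.Space d → ℝ, TorusDrift.IsSolution p b u ∧
          ¬ u =ᵐ[TorusDrift.torusMeasure d] 0 := by
    intro b₀ hb₀ ε hε
    obtain ⟨b, v, hb, hbd, hbε, hsol, hne⟩ :=
      TorusDrift.exists_drift_near (by omega) hp1 hen (Lp.memLp b₀) hb₀ hε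
    refine ⟨hb.toLp, hbd.congr_ae hb.coeFn_toLp.symm, ?_, v, hsol.congr_ae hb.coeFn_toLp.symm, hne⟩
    rw [← Lp.toLp_coeFn b₀ (Lp.memLp b₀), ← MemLp.toLp_sub, Lp.norm_toLp]
    exact ENNReal.toReal_le_of_le_ofReal hε.le hbε
  refine ⟨main, Metric.dense_iff.2 fun b₀ r hr => ?_⟩
  obtain ⟨b, hb, hbr, u, hu, hu0⟩ := main b₀.1 b₀.2 (r / 2) (half_pos hr)
  -- The second solution is zero.
  refine ⟨⟨b, hb⟩, ?_, u, 0, hu, TorusDrift.isSolution_zero _, hu0⟩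
  rw [Metric.mem_ball, Subtype.dist_eq, dist_eq_norm_sub]
  exact hbr.trans_lt (half_lt_self hr)
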